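/- We work in the two-dimensional abstract tile assembly model. A tile is a unit square with at most one glue on each side and a label (a finite string); each glue type has a strength in $\mathbb{N}$, and only equal abutting glues interact. An assembly is a finite set of tiles at distinct points of $\mathbb{Z}^2$. It is $\tau$-stable if every cut of its weighted bond graph has weight at least $\tau$. We write $A\to B$ if the $\tau$-stable assembly $A$ becomes the $\tau$-stable assembly $B$ by placing one tile of the tile set $T$ at an empty point. A tile system $(T,S,\tau)$ has $\tau\ge 1$ and a $\tau$-stable seed $S$; its producible assemblies are those reachable from $S$ by finitely many attachments, and it uniquely assembles $A$ if $A$ is its only terminal producible assembly (one to which no tile can attach). In one parallel step all tiles that can attach individually are attached simultaneously; the (parallel) run time is the number of parallel steps that lead from $S$ to the unique terminal assembly. An $m$-bit input template over $T$ consists of tiles $t_0,t_1\in T$ labelled "0" and "1", a fixed assembly $R$ of tiles of $T$ that are not labelled "0" or "1", and $m$ distinct wildcard points outside $R$. The seed $U_r$ for $r\in\{0,1\}^m$ is $R$ with the $i$-th wildcard point filled by $t_{r_i}$. A $k$-bit output template is a sequence $V$ of $k$ points. A tile assembly computer (TAC) $(T,U,V,\tau)$ computes $f:\{0,1\}^m\to\{0,1\}^k$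 if for every $r$, $(T,U_r,\tau)$ is a tile system that uniquely assembles an assembly whose tile at $V(i)$ has label $f(r)_i$ for all $i$. An $n$-bit adder TAC is one that computes $f:\{0,1\}^{2n}\to\{0,1\}^{n+1}$, where $f(r_1\ldots r_{2n})$ is the sum of the binary numbers $a=r_1\ldots r_n$ and $b=r_{n+1}\ldots r_{2n}$. **Theorem.** There are a finite tile set $T$ with glue strengths, a temperature $\tau$ and a constant $C$ such that for every positive integer $n$ there is an $n$-bit adder TAC with tile set $T$ and temperature $\tau$, whose input template lies on a line (the tiles of $R$ and the wildcard points are all in one row), with the following properties. 1. Its worst-case run time is at most $Cn$. 2. If $n\ge 2$, its average run time over the $2^{2n}$ equally likely inputs is at most $C\log n$. 3. On every input $(a,b)$ its run time is at most $C(k+1)$, where $k$ is the length of the longest block of consecutive bit positions at which $a$ and $b$ have different bits. -/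

import Mathlib

open scoped ENNReal

noncomputable section

namespace TileAssembly

/-- The four sides of a unit square tile. -/
inductive Side where
  | north | east | south | west
  deriving DecidableEq

instance : Fintype Side where
  elems := {.north, .east, .south, .west}
  complete := by intro d; cases d <;> decide

/-- The displacement from a tile location to the location across the given side. -/
def Side.vec : Side → ℤ × ℤ
  | .north => (0, 1)
  | .east => (1, 0)
  | .south => (0, -1)
  | .west => (-1, 0)

def Side.opposite : Side → Side
  | .north => .south
  | .east => .west
  | .south => .north
  | .west => .east

/-- A unit square tile over the glue alphabet `G`: at most one glue on each side, and a label,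
which is a finite string. The labels that matter are the one-letter strings `[false]` ("0") and
`[true]` ("1"). -/
structure Tile (G : Type) where
  glue : Side → Option G
  label : List Bool

/-- A finite tile set, together with the strength function of its glues. -/
structure TileSet (G : Type) where
  tiles : Finset (Tile G)
  str : G → ℕ

/-- An assembly: finitely many tiles at pairwise distinct points of `ℤ × ℤ`. -/
@[ext]
structure Assembly (G : Type) where
  tile : ℤ × ℤ → Option (Tile G)
  finite_support : {p | tile p ≠ none}.Finite

/-- The finite set of locations of the tiles of an assembly. -/
def Assembly.dom {G : Type} (A : Assembly G) : Finset (ℤ × ℤ) :=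
  A.finite_support.toFinset

/-- The strength of two overlapping glues: only equal glues interact. -/
def glueStrength {G : Type} [DecidableEq G] (str : G → ℕ) : Option G → Option G → ℕ
  | some g, some h => if g = h then str g else 0
  | _, _ => 0

/-- The weight in the bond graph of the edge between locations `p` and `q` of an assembly. -/
def Assembly.bond {G : Type} [DecidableEq G] (str : G → ℕ) (A : Assembly G)
    (p q : ℤ × ℤ) : ℕ :=
  ∑ d : Side, if q = p + d.vec then
    match A.tile p, A.tile q with
    | some t, some u => glueStrength str (t.glue d) (u.glue d.opposite)
    | _, _ => 0
  else 0

/-- `τ`-stability: every cut of the bond graph into two nonempty parts has weight at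
least `τ`. -/
def Assembly.Stable {G : Type} [DecidableEq G] (str : G → ℕ) (τ : ℕ) (A : Assembly G) : Prop :=
  ∀ X : Finset (ℤ × ℤ), X ⊆ A.dom → X.Nonempty → X ≠ A.dom →
    τ ≤ ∑ p ∈ X, ∑ q ∈ A.dom \ X, A.bond str p q

/-- The data of a tile system `(T, S, τ)`. -/
structure TileSystem (G : Type) where
  T : TileSet G
  seed : Assembly G
  temp : ℕ

namespace TileSystem

variable {G : Type} [DecidableEq G]

/-- The requirements on a tile system: positive temperature and a stable seed. -/
def IsValid (Γ : TileSystem G) : Prop :=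
  0 < Γ.temp ∧ Γ.seed.Stable Γ.T.str Γ.temp

/-- `A → B`: a single tile of `T` attaches to the stable assembly `A` at an empty location, and
the result `B` is stable. -/
def Attaches (Γ : TileSystem G) (A B : Assembly G) : Prop :=
  A.Stable Γ.T.str Γ.temp ∧ B.Stable Γ.T.str Γ.temp ∧
    ∃ t ∈ Γ.T.tiles, ∃ p : ℤ × ℤ, A.tile p = none ∧ B.tile = Function.update A.tile p (some t)

/-- The producible assemblies. -/
def Producible (Γ : TileSystem G) : Set (Assembly G) :=
  {A | Relation.ReflTransGen Γ.Attaches Γ.seed A}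

/-- The terminal assemblies: producible, and no tile can attach. -/
def Terminal (Γ : TileSystem G) : Set (Assembly G) :=
  {A | A ∈ Γ.Producible ∧ ∀ B, ¬ Γ.Attaches A B}

def UniquelyAssembles (Γ : TileSystem G) (A : Assembly G) : Prop :=
  Γ.Terminal = {A}

/-- One parallel step `A ⇉ A'`: `A'` is the union of `A` with all the assemblies that
result from `A` by one attachment. If two different tiles could attach at the same location, this
union is not an assembly, and there is no such `A'`. -/
def ParallelStep (Γ : TileSystem G) (A A' : Assembly G) : Prop :=
  ∀ p t, A'.tile p = some t ↔
    A.tile p = some t ∨ ∃ B, Γ.Attaches A B ∧ B.tile p = some t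

/-- `A` becomes `B` in exactly `k` parallel steps. -/
def ParallelSteps (Γ : TileSystem G) : ℕ → Assembly G → Assembly G → Prop
  | 0, A, B => A = B
  | k + 1, A, B => ∃ A', Γ.ParallelSteps k A A' ∧ Γ.ParallelStep A' B

/-- The parallel run time: the least number of parallel steps that lead from the seed to the
unique terminal assembly, and `⊤` if this never happens. -/
def runTime (Γ : TileSystem G) : ℕ∞ :=
  ⨅ k ∈ {k : ℕ | ∃ A, Γ.ParallelSteps k Γ.seed A ∧ Γ.UniquelyAssembles A}, (k : ℕ∞)

end TileSystem

/-- An `m`-bit input template over `T`: a fixed assembly `frame`, `m` distinct wildcard locations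
outside it, and the one tile `t₀` labelled "0" and the one tile `t₁` labelled "1" that may fill
a wildcard. The tiles of the frame are tiles of `T` that are not labelled "0" or "1". -/
structure InputTemplate {G : Type} (T : TileSet G) (m : ℕ) where
  t₀ : Tile G
  t₁ : Tile G
  t₀_mem : t₀ ∈ T.tiles
  t₁_mem : t₁ ∈ T.tiles
  t₀_label : t₀.label = [false]
  t₁_label : t₁.label = [true]
  frame : Assembly G
  frame_over : ∀ p t, frame.tile p = some t →
    t ∈ T.tiles ∧ t.label ≠ [false] ∧ t.label ≠ [true]
  wild : Fin m → ℤ × ℤ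
  wild_injective : Function.Injective wild
  wild_free : ∀ i, frame.tile (wild i) = none

namespace InputTemplate

variable {G : Type} {T : TileSet G} {m : ℕ}

/-- The tile that encodes a bit. -/
def bitTile (U : InputTemplate T m) (x : Bool) : Tile G :=
  if x then U.t₁ else U.t₀

open Classical in
/-- The tile at each location of the filled-in template. -/
def fillTile (U : InputTemplate T m) (b : Fin m → Bool) (p : ℤ × ℤ) : Option (Tile G) :=
  if h : ∃ i, U.wild i = p then some (U.bitTile (b h.choose)) else U.frame.tile p

/-- The seed `U_b`: the frame with the `i`-th wildcard filled according to the bit `b i`. -/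
def fill (U : InputTemplate T m) (b : Fin m → Bool) : Assembly G where
  tile := U.fillTile b
  finite_support := by
    refine ((Set.finite_range U.wild).union U.frame.finite_support).subset ?_
    intro p hp
    by_cases h : ∃ i, U.wild i = p
    · exact Or.inl h
    · right
      simpa [fillTile, h] using hp

theorem fill_wild (U : InputTemplate T m) (b : Fin m → Bool) (i : Fin m) :
    (U.fill b).tile (U.wild i) = some (U.bitTile (b i)) := by
  have h : ∃ j, U.wild j = U.wild i := ⟨i, rfl⟩
  have hc : h.choose = i := U.wild_injective h.choose_spec
  change U.fillTile b (U.wild i) = _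
  rw [fillTile, dif_pos h, hc]

theorem fill_frame (U : InputTemplate T m) (b : Fin m → Bool) (p : ℤ × ℤ)
    (hp : ∀ i, U.wild i ≠ p) : (U.fill b).tile p = U.frame.tile p := by
  change U.fillTile b p = _
  rw [fillTile, dif_neg (by simpa using hp)]

/-- The template is laid out on a line: the frame and all wildcards lie in one horizontal row. -/
def OnLine (U : InputTemplate T m) : Prop :=
  ∃ y : ℤ, (∀ p ∈ U.frame.dom, p.2 = y) ∧ ∀ i, (U.wild i).2 = y

end InputTemplate

/-- A tile assembly computer `(T, U, V, τ)` with `m` input bits and `k` output bits; the output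
template `V` is a sequence of `k` locations. -/
structure TAC (G : Type) (m k : ℕ) where
  T : TileSet G
  U : InputTemplate T m
  V : Fin k → ℤ × ℤ
  temp : ℕ

/-- The assembly `A` represents the bit string `c` over the output template `V`. -/
def Assembly.Represents {G : Type} {k : ℕ} (A : Assembly G) (V : Fin k → ℤ × ℤ)
    (c : Fin k → Bool) : Prop :=
  ∀ i, ∃ t, A.tile (V i) = some t ∧ t.label = [c i]

/-- The number whose binary numeral is `b`, most significant bit first. -/
def binaryValue {n : ℕ} (b : Fin n → Bool) : ℕ :=
  ∑ i, (b i).toNat * 2 ^ (i.rev : ℕ)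

/-- The `k`-bit binary numeral of `N`, most significant bit first. -/
def binaryDigits (k N : ℕ) : Fin k → Bool :=
  fun i => N.testBit (i.rev : ℕ)

/-- The first and the second addend in an input string of length `2n`. -/
def addendA {n : ℕ} (r : Fin (n + n) → Bool) : Fin n → Bool := fun i => r (Fin.castAdd n i)

def addendB {n : ℕ} (r : Fin (n + n) → Bool) : Fin n → Bool := fun i => r (Fin.natAdd n i)

/-- The function that an `n`-bit adder computes. -/
def addBits (n : ℕ) (r : Fin (n + n) → Bool) : Fin (n + 1) → Bool :=
  binaryDigits (n + 1) (binaryValue (addendA r) + binaryValue (addendB r))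

/-- The length of the longest block of consecutive bit positions at which the two addends
have unequal bits. -/
def longestUnequalRun {n : ℕ} (r : Fin (n + n) → Bool) : ℕ :=
  sSup {k : ℕ | ∃ s : ℕ, s + k ≤ n ∧
    ∀ j : Fin n, s ≤ (j : ℕ) → (j : ℕ) < s + k → addendA r j ≠ addendB r j}

namespace TAC

variable {G : Type} [DecidableEq G] {m k : ℕ}

/-- The tile system `(T, U_b, τ)`. -/
def system (M : TAC G m k) (b : Fin m → Bool) : TileSystem G where
  T := M.T
  seed := M.U.fill b
  temp := M.temp

def Computes (M : TAC G m k) (f : (Fin m → Bool) → (Fin k → Bool)) : Prop :=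
  ∀ b, (M.system b).IsValid ∧
    ∃ A, (M.system b).UniquelyAssembles A ∧ A.Represents M.V (f b)

def IsAdder {n : ℕ} (M : TAC G (n + n) (n + 1)) : Prop :=
  M.Computes (addBits n)

/-- The run time on input `b`. -/
def runTime (M : TAC G m k) (b : Fin m → Bool) : ℕ∞ :=
  (M.system b).runTime

def worstCaseRunTime (M : TAC G m k) : ℕ∞ :=
  ⨆ b, M.runTime b

/-- The mean run time over the `2 ^ m` input strings. -/
def averageRunTime (M : TAC G m k) : ℝ≥0∞ :=
  (∑ b, (M.runTime b : ℝ≥0∞)) / 2 ^ m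

end TAC

end TileAssembly

end

noncomputable section

namespace TileAssembly

/-! ### Deterministic growth: attachment, certificates and parallel run time. -/

section Growth

variable {G : Type}

/-! The adder works like a carry-skip circuit. The seed row lists the positions from west to east,
least significant bit first, each as three columns: the bit `a i`, a spacer, the bit `b i`. Where
the two bits agree, the carry out of the position is already known to be the common bit, so a `gen`
tile emits it after three steps without waiting. Where they differ, the carry passes through
unchanged, and a `prop` tile has to wait for it. So a carry travels only across runs of unequal
bits, three columns per position, and the run time is at most `8 + 3 * L`, with `L` the longest such
run (`adder_spec`). Padding positions with bits 0, 0 at both ends create the initial carry 0 and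
receive the top digit of the sum.

Correctness of growth and run time both follow from a certificate `GrowsTo`: a final assembly `F`
and a rank function such that, at sites outside the seed, no foreign tile binds strongly enough even
to all of `F`, and each non-seed tile of `F` is held by neighbours of smaller rank. Support is
monotone in the assembly, so only tiles of `F` ever attach, and after `k` parallel steps all tiles
of rank at most `k` are present (`GrowsTo.spec`). The certificate is local: uniqueness is a finite
check on triples of adjacent columns, and `fits_column` glues these checks together.

Worst case and bound by `L` are then immediate. For the average, a union bound gives `L > m` with
probability at most `n / 2 ^ m`. With `2 ^ m ≥ n ^ 2` the rare long runs contribute at most 1 to the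
mean of `L`, which is therefore at most `m + 1 = O(log n)`. -/

theorem Side.opposite_vec (d : Side) : d.opposite.vec = -d.vec := by
  cases d <;> simp [Side.opposite, Side.vec]

theorem Side.opposite_opposite (d : Side) : d.opposite.opposite = d := by
  cases d <;> rfl

theorem Side.sum_eq {M : Type*} [AddCommMonoid M] (f : Side → M) :
    ∑ d, f d = f .north + (f .east + (f .south + f .west)) := by
  change ∑ d ∈ ({.north, .east, .south, .west} : Finset Side), f d = _
  simp

theorem Assembly.mem_dom {A : Assembly G} {p : ℤ × ℤ} : p ∈ A.dom ↔ A.tile p ≠ none := by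
  simp [Assembly.dom]

theorem Assembly.dom_update {A B : Assembly G} {p : ℤ × ℤ} {t : Tile G}
    (hB : B.tile = Function.update A.tile p (some t)) : B.dom = insert p A.dom := by
  ext q
  simp only [Assembly.mem_dom, Finset.mem_insert, hB]
  by_cases h : q = p <;> simp [h]

theorem Assembly.le_update {A B : Assembly G} {p : ℤ × ℤ} {t : Tile G}
    (hp : A.tile p = none) (hB : B.tile = Function.update A.tile p (some t)) (q : ℤ × ℤ)
    (u : Tile G) (h : A.tile q = some u) : B.tile q = some u := by
  have : q ≠ p := by rintro rfl; simp [hp] at h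
  simp [hB, this, h]

variable [DecidableEq G]

theorem glueStrength_comm (str : G → ℕ) (g h : Option G) :
    glueStrength str g h = glueStrength str h g := by
  cases g <;> cases h <;> simp only [glueStrength]
  split_ifs <;> simp_all

/-- The strength with which a tile `t` binds to an optional neighbour across side `d`. -/
def Tile.bind (str : G → ℕ) (t : Tile G) (d : Side) : Option (Tile G) → ℕ
  | some u => glueStrength str (t.glue d) (u.glue d.opposite)
  | none => 0

/-- The total strength with which a tile `t` at `p` binds to its neighbours in `A`. -/
def Assembly.support (str : G → ℕ) (A : Assembly G) (t : Tile G) (p : ℤ × ℤ) : ℕ :=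
  ∑ d, t.bind str d (A.tile (p + d.vec))

theorem Assembly.bond_comm (str : G → ℕ) (A : Assembly G) (p q : ℤ × ℤ) :
    A.bond str p q = A.bond str q p := by
  unfold Assembly.bond
  let e : Side ≃ Side :=
    ⟨Side.opposite, Side.opposite, Side.opposite_opposite, Side.opposite_opposite⟩
  rw [← e.sum_comp]
  refine Finset.sum_congr rfl fun d _ => ?_
  have h : q = p + (e d).vec ↔ p = q + d.vec := by
    change q = p + d.opposite.vec ↔ _
    rw [Side.opposite_vec]
    constructor <;> rintro rfl <;> simp
  simp only [h]
  split_ifs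
  · change (match A.tile p, A.tile q with
      | some t, some u => glueStrength str (t.glue d.opposite) (u.glue d.opposite.opposite)
      | _, _ => 0) = _
    rw [Side.opposite_opposite]
    cases A.tile p <;> cases A.tile q <;> simp [glueStrength_comm]
  · rfl

theorem Assembly.bond_mono {str : G → ℕ} {A B : Assembly G}
    (h : ∀ p t, A.tile p = some t → B.tile p = some t) (p q : ℤ × ℤ) :
    A.bond str p q ≤ B.bond str p q := by
  unfold Assembly.bond
  refine Finset.sum_le_sum fun d _ => ?_
  split_ifs
  · cases hp : A.tile p <;> cases hq : A.tile q <;> simp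
    rw [h _ _ hp, h _ _ hq]
  · rfl

theorem Assembly.support_mono {str : G → ℕ} {A B : Assembly G}
    (h : ∀ p t, A.tile p = some t → B.tile p = some t) (t : Tile G) (p : ℤ × ℤ) :
    A.support str t p ≤ B.support str t p := by
  refine Finset.sum_le_sum fun d _ => ?_
  cases hp : A.tile (p + d.vec)
  · simp [Tile.bind]
  · rw [h _ _ hp]

/-- The bonds between a tile at `p` and a set of locations that contains all the other tiles. -/
theorem Assembly.sum_bond_eq_support {str : G → ℕ} {A B : Assembly G} {p : ℤ × ℤ} {t : Tile G}
    (hp : A.tile p = none) (hB : B.tile = Function.update A.tile p (some t)) :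
    ∑ q ∈ A.dom, B.bond str p q = A.support str t p := by
  unfold Assembly.bond Assembly.support
  rw [Finset.sum_comm]
  refine Finset.sum_congr rfl fun d _ => ?_
  rw [Finset.sum_ite_eq' A.dom (p + d.vec)]
  have hpB : B.tile p = some t := by simp [hB]
  split_ifs with h
  · have hne : p + d.vec ≠ p := by rintro h'; rw [h', Assembly.mem_dom] at h; exact h hp
    have : B.tile (p + d.vec) = A.tile (p + d.vec) := by simp [hB, hne]
    rw [hpB, this]
    cases A.tile (p + d.vec) <;> rfl
  · rw [Assembly.mem_dom, not_not] at h
    rw [h]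
    rfl

/-- A cut that separates the new tile from everything else weighs exactly its support. Every other
cut restricts to a proper cut of `A`, and adding a tile only adds bonds. -/
theorem Assembly.Stable.update {str : G → ℕ} {τ : ℕ} {A B : Assembly G} {p : ℤ × ℤ} {t : Tile G}
    (hA : A.Stable str τ) (hp : A.tile p = none)
    (hB : B.tile = Function.update A.tile p (some t)) (h : τ ≤ A.support str t p) :
    B.Stable str τ := by
  intro X hX hne hX'
  have hmono := Assembly.bond_mono (str := str) (Assembly.le_update hp hB)
  rw [Assembly.dom_update hB] at hX hX' ⊢
  have hpA : p ∉ A.dom := by simp [Assembly.mem_dom, hp]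
  rw [← Assembly.sum_bond_eq_support hp hB] at h
  by_cases hpX : p ∈ X
  · have hdiff : insert p A.dom \ X = A.dom \ X.erase p := by
      ext q
      simp only [Finset.mem_sdiff, Finset.mem_insert, Finset.mem_erase]
      by_cases hq : q = p
      · subst hq; simp [hpX, hpA]
      · simp [hq]
    rw [hdiff]
    by_cases hX0 : X.erase p = ∅
    · rw [hX0, Finset.sdiff_empty]
      exact h.trans (Finset.single_le_sum (f := fun p => ∑ q ∈ A.dom, B.bond str p q)
        (fun _ _ => Nat.zero_le _) hpX)
    · have hsub : X.erase p ⊆ A.dom := fun q hq => by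
        have := hX (Finset.mem_of_mem_erase hq)
        exact (Finset.mem_insert.1 this).resolve_left (Finset.ne_of_mem_erase hq)
      have hprop : X.erase p ≠ A.dom := by
        intro he
        apply hX'
        rw [← he, Finset.insert_erase hpX]
      refine (hA _ hsub (Finset.nonempty_iff_ne_empty.2 hX0) hprop).trans ?_
      refine (Finset.sum_le_sum fun a _ => Finset.sum_le_sum fun b _ => hmono a b).trans ?_
      exact Finset.sum_le_sum_of_subset (Finset.erase_subset _ _)
  · have hsub : X ⊆ A.dom := fun q hq =>
      (Finset.mem_insert.1 (hX hq)).resolve_left (by rintro rfl; exact hpX hq)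
    by_cases hXA : X = A.dom
    · subst hXA
      refine h.trans (Finset.sum_le_sum fun q _ => ?_)
      rw [Assembly.bond_comm]
      exact Finset.single_le_sum (f := fun p => B.bond str q p) (fun _ _ => Nat.zero_le _)
        (by simp [hpX])
    · refine (hA _ hsub hne hXA).trans ?_
      refine (Finset.sum_le_sum fun a _ => Finset.sum_le_sum fun b _ => hmono a b).trans ?_
      refine Finset.sum_le_sum fun a _ => Finset.sum_le_sum_of_subset ?_
      exact Finset.sdiff_subset_sdiff (Finset.subset_insert _ _) le_rfl

/-- Stability is applied to the cut that isolates the new tile; `A` must be nonempty for this cut to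
be proper. -/
theorem Assembly.Stable.le_support {str : G → ℕ} {τ : ℕ} {A B : Assembly G} {p : ℤ × ℤ}
    {t : Tile G} (hB' : B.Stable str τ) (hA : A.dom.Nonempty) (hp : A.tile p = none)
    (hB : B.tile = Function.update A.tile p (some t)) : τ ≤ A.support str t p := by
  have hpA : p ∉ A.dom := by simp [Assembly.mem_dom, hp]
  have hdiff : insert p A.dom \ {p} = A.dom := by
    ext q
    simp only [Finset.mem_sdiff, Finset.mem_insert, Finset.mem_singleton]
    constructor
    · rintro ⟨h, h'⟩; exact h.resolve_left h'
    · intro h; exact ⟨Or.inr h, by rintro rfl; exact hpA h⟩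
  have := hB' {p} (by simp [Assembly.dom_update hB]) (by simp) (by
    intro h
    obtain ⟨q, hq⟩ := hA
    have h' : q ∈ ({p} : Finset _) := by
      rw [h, Assembly.dom_update hB]; exact Finset.mem_insert_of_mem hq
    rw [Finset.mem_singleton] at h'
    exact hpA (h' ▸ hq))
  rwa [Assembly.dom_update hB, hdiff, Finset.sum_singleton,
    Assembly.sum_bond_eq_support hp hB] at this

/-- Certificate for deterministic growth of `Γ` to `F`: no tile other than that of `F` can bind
anywhere, even to the complete assembly `F`, and every tile of `F` outside the seed is held by
neighbours of smaller rank. -/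
structure GrowsTo (Γ : TileSystem G) (F : Assembly G) (ρ : ℤ × ℤ → ℕ) : Prop where
  temp_pos : 0 < Γ.temp
  stable : Γ.seed.Stable Γ.T.str Γ.temp
  nonempty : Γ.seed.dom.Nonempty
  seed_le : ∀ p t, Γ.seed.tile p = some t → F.tile p = some t
  mem_tiles : ∀ p t, F.tile p = some t → t ∈ Γ.T.tiles
  unique : ∀ p, Γ.seed.tile p = none → ∀ t ∈ Γ.T.tiles, Γ.temp ≤ F.support Γ.T.str t p →
    F.tile p = some t
  supported : ∀ p t, F.tile p = some t → Γ.seed.tile p = none →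
    Γ.temp ≤ ∑ d, if ρ (p + d.vec) < ρ p then t.bind Γ.T.str d (F.tile (p + d.vec)) else 0

/-- `A` lies between the seed of `Γ` and `F`, and is stable. -/
structure Partial (Γ : TileSystem G) (F A : Assembly G) : Prop where
  stable : A.Stable Γ.T.str Γ.temp
  seed_le : ∀ p t, Γ.seed.tile p = some t → A.tile p = some t
  le : ∀ p t, A.tile p = some t → F.tile p = some t

namespace GrowsTo

variable {Γ : TileSystem G} {F A B : Assembly G} {ρ : ℤ × ℤ → ℕ}

theorem partial_seed (h : GrowsTo Γ F ρ) : Partial Γ F Γ.seed :=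
  ⟨h.stable, fun _ _ => id, h.seed_le⟩

/-- A tile that binds to `A` binds at least as strongly to the larger `F`, where `unique` identifies
it. Thus global stability is replaced by the support at one site. -/
theorem attaches_iff (h : GrowsTo Γ F ρ) (hA : Partial Γ F A) :
    Γ.Attaches A B ↔ ∃ p t, A.tile p = none ∧ F.tile p = some t ∧
      Γ.temp ≤ A.support Γ.T.str t p ∧ B.tile = Function.update A.tile p (some t) := by
  constructor
  · rintro ⟨-, hB, t, ht, p, hp, hBA⟩
    have hne : A.dom.Nonempty := by
      obtain ⟨q, hq⟩ := h.nonempty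
      rw [Assembly.mem_dom] at hq
      obtain ⟨u, hu⟩ := Option.ne_none_iff_exists'.1 hq
      exact ⟨q, by simp [Assembly.mem_dom, hA.seed_le q u hu]⟩
    have hs := hB.le_support hne hp hBA
    refine ⟨p, t, hp, h.unique p ?_ t ht (hs.trans (Assembly.support_mono hA.le t p)), hs, hBA⟩
    by_contra hc
    obtain ⟨u, hu⟩ := Option.ne_none_iff_exists'.1 hc
    simp [hA.seed_le p u hu] at hp
  · rintro ⟨p, t, hp, hF, hs, hBA⟩
    exact ⟨hA.stable, hA.stable.update hp hBA hs, t, h.mem_tiles p t hF, p, hp, hBA⟩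

theorem partial_of_attaches (h : GrowsTo Γ F ρ) (hA : Partial Γ F A) (hAB : Γ.Attaches A B) :
    Partial Γ F B := by
  refine ⟨hAB.2.1, ?_, ?_⟩ <;> obtain ⟨p, t, hp, hF, -, hBA⟩ := (h.attaches_iff hA).1 hAB
  · exact fun q u hu => Assembly.le_update hp hBA q u (hA.seed_le q u hu)
  · intro q u hu
    by_cases hq : q = p
    · subst hq
      rw [hBA, Function.update_self] at hu
      rw [hF, hu]
    · rw [hBA, Function.update_of_ne hq] at hu
      exact hA.le q u hu

theorem partial_of_producible (h : GrowsTo Γ F ρ) (hA : A ∈ Γ.Producible) : Partial Γ F A := by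
  induction hA with
  | refl => exact h.partial_seed
  | tail _ hAB ih => exact h.partial_of_attaches ih hAB

/-- Attaching in sequence tiles that can all attach to `A`. -/
theorem producible_of_supported (h : GrowsTo Γ F ρ) (hA : A ∈ Γ.Producible)
    (hAB : ∀ p t, A.tile p = some t → B.tile p = some t)
    (hBF : ∀ p t, B.tile p = some t → F.tile p = some t)
    (hs : ∀ p t, B.tile p = some t → A.tile p = none → Γ.temp ≤ A.support Γ.T.str t p) :
    B ∈ Γ.Producible := by
  obtain ⟨m, hm⟩ : ∃ m, (B.dom \ A.dom).card = m := ⟨_, rfl⟩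
  induction m generalizing A with
  | zero =>
    rw [Finset.card_eq_zero, Finset.sdiff_eq_empty_iff_subset] at hm
    suffices A = B by rwa [← this]
    ext1
    funext p
    cases hp : A.tile p with
    | some t => rw [hAB p t hp]
    | none =>
      by_contra hc
      exact Assembly.mem_dom.1 (hm (Assembly.mem_dom.2 (Ne.symm hc))) hp
  | succ m ih =>
    obtain ⟨p, hp⟩ : (B.dom \ A.dom).Nonempty := by
      rw [← Finset.card_pos]; omega
    have hp' := hp
    rw [Finset.mem_sdiff, Assembly.mem_dom, Assembly.mem_dom, not_not] at hp
    obtain ⟨t, ht⟩ := Option.ne_none_iff_exists'.1 hp.1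
    let A' : Assembly G :=
      ⟨Function.update A.tile p (some t), (A.finite_support.insert p).subset (by
        intro q hq
        by_cases hqp : q = p
        · exact Or.inl hqp
        · right
          simpa [hqp] using hq)⟩
    have hA' : A'.tile = Function.update A.tile p (some t) := rfl
    have hle := Assembly.le_update hp.2 hA'
    have hatt : Γ.Attaches A A' := (h.attaches_iff (h.partial_of_producible hA)).2
      ⟨p, t, hp.2, hBF p t ht, hs p t ht hp.2, rfl⟩
    refine ih (A := A') (Relation.ReflTransGen.tail hA hatt) ?_ ?_ ?_
    · intro q u hu
      by_cases hq : q = p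
      · subst hq
        rw [hA', Function.update_self] at hu
        rw [ht, hu]
      · rw [hA', Function.update_of_ne hq] at hu
        exact hAB q u hu
    · intro q u hu hq
      refine (hs q u hu ?_).trans (Assembly.support_mono hle u q)
      by_contra hc
      obtain ⟨v, hv⟩ := Option.ne_none_iff_exists'.1 hc
      simp [hle q v hv] at hq
    · rw [Assembly.dom_update hA', Finset.sdiff_insert, Finset.card_erase_of_mem hp', hm]
      rfl

open Classical in
/-- The result of one parallel step inside `F`. -/
def next (Γ : TileSystem G) (F A : Assembly G) : Assembly G where
  tile p := if A.tile p = none then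
      if ∃ t, F.tile p = some t ∧ Γ.temp ≤ A.support Γ.T.str t p then F.tile p else none
    else A.tile p
  finite_support := by
    refine (A.finite_support.union F.finite_support).subset ?_
    intro p hp
    simp only [Set.mem_ofPred_eq, Set.mem_union] at hp ⊢
    by_contra! hc
    simp [hc] at hp

theorem next_tile_iff (p : ℤ × ℤ) (t : Tile G) :
    (next Γ F A).tile p = some t ↔ A.tile p = some t ∨
      (A.tile p = none ∧ F.tile p = some t ∧ Γ.temp ≤ A.support Γ.T.str t p) := by
  unfold next
  simp only
  split_ifs with h1 h2
  · obtain ⟨u, hu, hs⟩ := h2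
    simp only [h1, hu, Option.some.injEq, reduceCtorEq, true_and, false_or]
    constructor
    · rintro rfl; exact ⟨rfl, hs⟩
    · exact And.left
  · simp only [h1, reduceCtorEq, true_and, false_or, false_iff]
    exact fun h => h2 ⟨t, h⟩
  · simp [h1]

theorem parallelStep_next (h : GrowsTo Γ F ρ) (hA : Partial Γ F A) :
    Γ.ParallelStep A (next Γ F A) := by
  intro p t
  rw [next_tile_iff]
  constructor
  · rintro (h1 | ⟨h1, h2, h3⟩)
    · exact Or.inl h1
    · right
      let B : Assembly G :=
        ⟨Function.update A.tile p (some t), (A.finite_support.insert p).subset (by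
          intro q hq
          by_cases hqp : q = p
          · exact Or.inl hqp
          · right
            simpa [hqp] using hq)⟩
      exact ⟨B, (h.attaches_iff hA).2 ⟨p, t, h1, h2, h3, rfl⟩, by simp [B]⟩
  · rintro (h1 | ⟨B, hB, ht⟩)
    · exact Or.inl h1
    · obtain ⟨q, u, hq, hF, hs, hBA⟩ := (h.attaches_iff hA).1 hB
      by_cases hp : p = q
      · subst hp
        rw [hBA, Function.update_self, Option.some.injEq] at ht
        subst ht
        exact Or.inr ⟨hq, hF, hs⟩
      · rw [hBA, Function.update_of_ne hp] at ht
        exact Or.inl ht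

theorem producible_next (h : GrowsTo Γ F ρ) (hA : A ∈ Γ.Producible) :
    next Γ F A ∈ Γ.Producible := by
  have hP := h.partial_of_producible hA
  refine h.producible_of_supported hA (fun p t ht => (next_tile_iff p t).2 (Or.inl ht)) ?_ ?_
  · intro p t ht
    rcases (next_tile_iff p t).1 ht with h1 | h1
    · exact hP.le p t h1
    · exact h1.2.1
  · intro p t ht hp
    rcases (next_tile_iff p t).1 ht with h1 | h1
    · simp [hp] at h1
    · exact h1.2.2

/-- A tile of `F` can attach to `A` once the tiles of smaller rank are present. -/
theorem le_support (h : GrowsTo Γ F ρ) (hA : Partial Γ F A) {p : ℤ × ℤ} {t : Tile G}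
    (hp : F.tile p = some t) (hAp : A.tile p = none)
    (hlt : ∀ q u, F.tile q = some u → ρ q < ρ p → A.tile q = some u) :
    Γ.temp ≤ A.support Γ.T.str t p := by
  have hseed : Γ.seed.tile p = none := by
    by_contra hc
    obtain ⟨u, hu⟩ := Option.ne_none_iff_exists'.1 hc
    simp [hA.seed_le p u hu] at hAp
  refine (h.supported p t hp hseed).trans (Finset.sum_le_sum fun d _ => ?_)
  split_ifs with hd
  · cases hq : F.tile (p + d.vec) with
    | none => simp [Tile.bind]
    | some u => rw [hlt _ u hq hd]
  · exact Nat.zero_le _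

/-- A tile of rank `k + 1` finds all its supporting neighbours in place after `k` steps, hence
attaches in the next one if it is not already there. -/
theorem parallelSteps_exists (h : GrowsTo Γ F ρ) (k : ℕ) :
    ∃ A, Γ.ParallelSteps k Γ.seed A ∧ A ∈ Γ.Producible ∧
      ∀ p t, F.tile p = some t → ρ p ≤ k → A.tile p = some t := by
  induction k with
  | zero =>
    refine ⟨Γ.seed, rfl, Relation.ReflTransGen.refl, fun p t hp hρ => ?_⟩
    by_contra hc
    cases hs : Γ.seed.tile p with
    | some u =>
      have := h.seed_le p u hs
      rw [hp] at this
      exact hc (hs.trans this.symm)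
    | none =>
      -- No neighbour has rank below 0, so a non-seed tile of rank 0 would have no support at all.
      have hsup := h.supported p t hp hs
      simp only [Nat.le_zero.1 hρ, not_lt_zero, if_false, Finset.sum_const_zero,
        Nat.le_zero] at hsup
      exact absurd hsup h.temp_pos.ne'
  | succ k ih =>
    obtain ⟨A, hk, hA, hle⟩ := ih
    have hP := h.partial_of_producible hA
    refine ⟨next Γ F A, ⟨A, hk, h.parallelStep_next hP⟩, h.producible_next hA, ?_⟩
    intro p t hp hρ
    rw [next_tile_iff]
    cases hAp : A.tile p with
    | some u =>
      have := hP.le p u hAp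
      rw [hp] at this
      exact Or.inl this.symm
    | none =>
      exact Or.inr ⟨rfl, hp, h.le_support hP hp hAp fun q u hq hlt => hle q u hq (by omega)⟩

/-- In a producible assembly short of `F`, a missing tile of minimal rank can attach, so the
assembly is not terminal. -/
theorem uniquelyAssembles (h : GrowsTo Γ F ρ) (hF : F ∈ Γ.Producible) :
    Γ.UniquelyAssembles F := by
  ext A
  rw [Set.mem_singleton_iff]
  constructor
  · rintro ⟨hA, hterm⟩
    have hP := h.partial_of_producible hA
    by_contra hne
    have hex : {p | A.tile p = none ∧ F.tile p ≠ none}.Nonempty := by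
      by_contra hc
      rw [Set.not_nonempty_iff_eq_empty, Set.eq_empty_iff_forall_notMem] at hc
      apply hne
      ext1
      funext p
      cases hp : A.tile p with
      | some t => rw [hP.le p t hp]
      | none =>
        by_contra hc'
        exact hc p ⟨hp, Ne.symm hc'⟩
    let p := Function.argminOn ρ _ hex
    obtain ⟨hAp, hFp⟩ : p ∈ {p | A.tile p = none ∧ F.tile p ≠ none} :=
      Function.argminOn_mem ρ _ hex
    have hmin : ∀ q, q ∈ {p | A.tile p = none ∧ F.tile p ≠ none} → ρ p ≤ ρ q :=
      fun q hq => Function.argminOn_le ρ _ hq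
    obtain ⟨t, ht⟩ := Option.ne_none_iff_exists'.1 hFp
    have hs := h.le_support hP ht hAp fun q u hq hlt => by
      cases hAq : A.tile q with
      | some v => rw [← hq, hP.le q v hAq]
      | none => exact absurd (hmin q ⟨hAq, by simp [hq]⟩) (not_le.2 hlt)
    have hstep := (h.parallelStep_next hP p t).1 ((next_tile_iff p t).2 (Or.inr ⟨hAp, ht, hs⟩))
    rcases hstep with h1 | ⟨B, hB, -⟩
    · simp [hAp] at h1
    · exact hterm B hB
  · rintro rfl
    refine ⟨hF, fun B hB => ?_⟩
    obtain ⟨p, t, hp, hp', -⟩ := (h.attaches_iff (h.partial_of_producible hF)).1 hB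
    simp [hp] at hp'

theorem spec (h : GrowsTo Γ F ρ) {K : ℕ} (hK : ∀ p t, F.tile p = some t → ρ p ≤ K) :
    Γ.UniquelyAssembles F ∧ Γ.runTime ≤ K := by
  obtain ⟨A, hA, hAP, hAF⟩ := h.parallelSteps_exists K
  have hP := h.partial_of_producible hAP
  have : A = F := by
    ext1
    funext p
    cases hp : F.tile p with
    | some t => exact hAF p t hp (hK p t hp)
    | none =>
      by_contra hc
      obtain ⟨u, hu⟩ := Option.ne_none_iff_exists'.1 hc
      simp [hP.le p u hu] at hp
  subst this
  have hu := h.uniquelyAssembles hAP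
  exact ⟨hu, iInf₂_le K ⟨A, hA, hu⟩⟩

end GrowsTo

end Growth

/-! ### The tile set and its local checks. -/

namespace CarrySkip

/-- The glues of the carry-skip adder. -/
inductive Glue where
  | row | rail | skip | hold
  | bit (v : Bool)
  | left (v : Bool)
  | right (v : Bool)
  | gen (v : Bool)
  | carry (v : Bool)
  | wireTop (v : Bool)
  | propTop (v : Bool)
  | feed (v : Bool)
  deriving DecidableEq

/-- At temperature 3 a glue of strength 3 suffices alone, while the glues of strength 2 wait for a
partner of strength 1. This forces `join`, `prop`, `wire` and `out` to wait for two inputs. -/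
def strength : Glue → ℕ
  | .row | .bit _ | .gen _ | .wireTop _ | .propTop _ => 3
  | .rail | .skip | .hold | .left _ => 2
  | .right _ | .carry _ | .feed _ => 1

/-- The tile types of the carry-skip adder: the tiles `bit`, `mid`, `leftCap`, `rightCap` form the
seed row; `lift` and `join` compare the two bits of a position; `gen` starts a carry where the bits
agree, `prop` passes it on where they differ, and `wire` transports it to the next position;
`top`, `out` and `flip` form the digits of the sum. -/
inductive Kind where
  | bit (isInput v : Bool)
  | mid | leftCap | rightCap
  | lift (v : Bool)
  | join (u v : Bool)
  | gen (v : Bool)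
  | prop (c : Bool)
  | wire (c : Bool)
  | top (c : Bool)
  | out (c : Bool)
  | flip (c : Bool)
  deriving DecidableEq, Fintype

/-- `gen` has no west glue, so it ignores the incoming carry; that carry climbs to `top` and reaches
the digit `out` above `gen` through `feed`. The glues `left` and `right` differ, so `lift` tiles of
neighbouring positions do not interact. -/
def Kind.glue : Kind → Side → Option Glue
  | .bit _ v, .north => some (.bit v)
  | .bit _ _, .east => some .row
  | .bit _ _, .west => some .row
  | .mid, .east => some .row
  | .mid, .west => some .row
  | .leftCap, .east => some .row
  | .rightCap, .west => some .row
  | .lift v, .south => some (.bit v)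
  | .lift v, .east => some (.left v)
  | .lift v, .west => some (.right v)
  | .lift _, .north => some .rail
  | .join u _, .west => some (.left u)
  | .join _ v, .east => some (.right v)
  | .join u v, .north => some (if u = v then .gen u else .skip)
  | .gen v, .south => some (.gen v)
  | .gen v, .east => some (.carry v)
  | .gen _, .north => some .hold
  | .prop _, .south => some .skip
  | .prop c, .west => some (.carry c)
  | .prop c, .east => some (.carry c)
  | .prop c, .north => some (.propTop c)
  | .wire _, .south => some .rail
  | .wire c, .west => some (.carry c)
  | .wire c, .east => some (.carry c)
  | .wire c, .north => some (.wireTop c)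
  | .top c, .south => some (.wireTop c)
  | .top c, .east => some (.feed c)
  | .out _, .south => some .hold
  | .out c, .west => some (.feed c)
  | .flip c, .south => some (.propTop c)
  | _, _ => none

/-- Padding bits have the glues of input bits but no label, as the frame of a template requires. The
digit of a position with unequal bits is the negated carry. -/
def Kind.label : Kind → List Bool
  | .bit true v => [v]
  | .out c => [c]
  | .flip c => [!c]
  | _ => []

def Kind.tile (k : Kind) : Tile Glue := ⟨k.glue, k.label⟩

open Classical in
def tileSet : TileSet Glue := ⟨Finset.univ.image Kind.tile, strength⟩

theorem mem_tileSet {t : Tile Glue} : t ∈ tileSet.tiles ↔ ∃ k : Kind, k.tile = t := by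
  simp [tileSet]

/-- The strength with which `k` binds to an optional neighbour across side `d`. -/
def Kind.bind (k : Kind) (d : Side) : Option Kind → ℕ
  | some k' => glueStrength strength (k.glue d) (k'.glue d.opposite)
  | none => 0

theorem Kind.tile_bind (k : Kind) (d : Side) (o : Option Kind) :
    k.tile.bind strength d (o.map Kind.tile) = k.bind d o := by
  cases o <;> rfl

/-- A column of the final assembly: the tile type and the rank at each height. -/
structure Column where
  kind : ℤ → Option Kind
  rank : ℤ → ℕ

def bitKind (first isInput a c : Bool) (y : ℤ) : Option Kind :=
  if y = 0 then some (.bit isInput a) else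
  if y = 1 then some (.lift a) else
  if y = 2 then (if first then none else some (.wire c)) else
  if y = 3 then (if first then none else some (.top c)) else none

def midKind (first a b c : Bool) (y : ℤ) : Option Kind :=
  if y = 0 then some .mid else
  if y = 1 then some (.join a b) else
  if y = 2 then some (if a = b then .gen a else .prop c) else
  if y = 3 then (if a = b then (if first then none else some (.out c)) else some (.flip c))
  else none

def seedKind (k : Option Kind) (y : ℤ) : Option Kind :=
  if y = 0 then k else none

/-- The column over a summand bit, reached by the carry `c` at time `t`. -/
def bitColumn (first isInput a c : Bool) (t : ℕ) : Column where
  kind := bitKind first isInput a c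
  rank y := if y = 0 then 0 else if y = 1 then 1 else if y = 2 then t else t + 1

/-- The time at which the carry leaves a position with bits `a` and `b` that it reaches at
time `t`. -/
def carryTime (a b : Bool) (t : ℕ) : ℕ := if a = b then 3 else t + 1

def carryOut (a b c : Bool) : Bool := if a = b then a else c

/-- The column between the bits `a` and `b`, reached by the carry `c` at time `t`. -/
def midColumn (first a b c : Bool) (t : ℕ) : Column where
  kind := midKind first a b c
  rank y := if y = 0 then 0 else if y = 1 then 2 else if y = 2 then carryTime a b t else t + 2

/-- A column with at most a seed tile. -/
def seedColumn (k : Option Kind) : Column where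
  kind := seedKind k
  rank _ := 0

/-- `m` can stand between `l` and `r`, as far as deterministic growth is concerned. -/
structure Column.Fits (l m r : Column) : Prop where
  unique : ∀ y k, (y = 0 → m.kind 0 = none) →
    3 ≤ k.bind .north (m.kind (y + 1)) + (k.bind .east (r.kind y) +
      (k.bind .south (m.kind (y - 1)) + k.bind .west (l.kind y))) → m.kind y = some k
  supported : ∀ y k, y ≠ 0 → m.kind y = some k →
    3 ≤ (if m.rank (y + 1) < m.rank y then k.bind .north (m.kind (y + 1)) else 0) +
      ((if r.rank y < m.rank y then k.bind .east (r.kind y) else 0) +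
      ((if m.rank (y - 1) < m.rank y then k.bind .south (m.kind (y - 1)) else 0) +
      (if l.rank y < m.rank y then k.bind .west (l.kind y) else 0)))

def IsLow (f : ℤ → Option Kind) : Prop := ∀ y, y < 0 ∨ 3 < y → f y = none

theorem isLow_bitKind (first isInput a c : Bool) : IsLow (bitKind first isInput a c) := by
  intro y hy
  unfold bitKind
  split_ifs <;> first | rfl | omega

theorem isLow_midKind (first a b c : Bool) : IsLow (midKind first a b c) := by
  intro y hy
  unfold midKind
  split_ifs <;> first | rfl | omega

theorem isLow_seedKind (k : Option Kind) : IsLow (seedKind k) := by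
  intro y hy
  unfold seedKind
  split_ifs <;> first | rfl | omega

/-- The uniqueness condition at the heights where a neighbour is possible. -/
def UniqueAt (l m r : ℤ → Option Kind) : Prop :=
  ∀ y ∈ ([-1, 0, 1, 2, 3, 4] : List ℤ), ∀ k : Kind, (y = 0 → m 0 = none) →
    3 ≤ k.bind .north (m (y + 1)) + (k.bind .east (r y) +
      (k.bind .south (m (y - 1)) + k.bind .west (l y))) → m y = some k

instance (l m r : ℤ → Option Kind) : Decidable (UniqueAt l m r) := by
  unfold UniqueAt; infer_instance

/-- Outside heights -1 to 4 there are no neighbours to bind to, so a finite check covers all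
heights. -/
theorem UniqueAt.all {l m r : ℤ → Option Kind} (h : UniqueAt l m r) (hl : IsLow l) (hm : IsLow m)
    (hr : IsLow r) (y : ℤ) (k : Kind) (h0 : y = 0 → m 0 = none)
    (hs : 3 ≤ k.bind .north (m (y + 1)) + (k.bind .east (r y) +
      (k.bind .south (m (y - 1)) + k.bind .west (l y)))) : m y = some k := by
  by_cases hy : -1 ≤ y ∧ y ≤ 4
  · refine h y ?_ k h0 hs
    obtain ⟨h1, h2⟩ := hy
    interval_cases y <;> decide
  · rw [hm (y + 1) (by omega), hr y (by omega), hm (y - 1) (by omega), hl y (by omega)] at hs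
    simp [Kind.bind] at hs

/-- This and the following checks exhaust the triples of adjacent columns that occur in the final
assembly. -/
theorem uniqueAt_empty : UniqueAt (seedKind none) (seedKind none) (seedKind none) := by
  decide +kernel

theorem uniqueAt_before : UniqueAt (seedKind none) (seedKind none) (seedKind (some .leftCap)) := by
  decide +kernel

theorem uniqueAt_leftCap : ∀ i a c, UniqueAt (seedKind none) (seedKind (some .leftCap))
    (bitKind true i a c) := by
  decide +kernel

theorem uniqueAt_firstBit : ∀ i a c, UniqueAt (seedKind (some .leftCap)) (bitKind true i a c)
    (midKind true a a c) := by
  decide +kernel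

theorem uniqueAt_firstMid : ∀ i a c j, UniqueAt (bitKind true i a c) (midKind true a a c)
    (bitKind false j a a) := by
  decide +kernel

theorem uniqueAt_left : ∀ i a c j b d, UniqueAt (bitKind false i a c) (bitKind false j b c)
    (midKind false b d c) := by
  decide +kernel

theorem uniqueAt_mid : ∀ i a c j b, UniqueAt (bitKind false i a c) (midKind false a b c)
    (bitKind false j b (carryOut a b c)) := by
  decide +kernel

theorem uniqueAt_right : ∀ f a b c i j d, (f = true → a = b) →
    UniqueAt (midKind f a b c) (bitKind false i b (carryOut a b c))
      (bitKind false j d (carryOut a b c)) := by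
  decide +kernel

theorem uniqueAt_last : ∀ f a b c i, (f = true → a = b) →
    UniqueAt (midKind f a b c) (bitKind false i b (carryOut a b c))
      (seedKind (some .rightCap)) := by
  decide +kernel

theorem uniqueAt_rightCap : ∀ i a c, UniqueAt (bitKind false i a c) (seedKind (some .rightCap))
    (seedKind none) := by
  decide +kernel

theorem uniqueAt_after : UniqueAt (seedKind (some .rightCap)) (seedKind none) (seedKind none) := by
  decide +kernel

theorem fits_seedColumn {l r : Column} {o : Option Kind} (h : UniqueAt l.kind (seedKind o) r.kind)
    (hl : IsLow l.kind) (hr : IsLow r.kind) : Column.Fits l (seedColumn o) r where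
  unique := h.all hl (isLow_seedKind o) hr
  supported y k hy hk := by simp [seedColumn, seedKind, hy] at hk

theorem three_le_of_south {a b c d : ℕ} (h : 3 ≤ c) : 3 ≤ a + (b + (c + d)) := by omega

theorem fits_firstBit (i a c : Bool) (t : ℕ) : Column.Fits (seedColumn (some .leftCap))
    (bitColumn true i a c t) (midColumn true a a c t) where
  unique := (uniqueAt_firstBit i a c).all (isLow_seedKind _) (isLow_bitKind _ _ _ _)
    (isLow_midKind _ _ _ _)
  supported y k hy hk := by
    simp only [bitColumn, bitKind, hy, if_false, if_true] at hk
    split_ifs at hk with h1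
    cases hk
    subst h1
    apply three_le_of_south
    simp [bitColumn, bitKind, Kind.bind, Kind.glue, Side.opposite, glueStrength, strength]

/-- `lift` and `top` rest on a glue of strength 3. `wire` combines the `rail` below, present from
time 1, with the carry from the west, present before time `t`. -/
theorem supported_bitColumn {l r : Column} {i a c : Bool} {t : ℕ} (ht : 2 ≤ t)
    (hl : 1 ≤ (Kind.wire c).bind .west (l.kind 2)) (hlt : l.rank 2 < t) (y : ℤ) (k : Kind)
    (hy : y ≠ 0) (hk : (bitColumn false i a c t).kind y = some k) :
    letI m := bitColumn false i a c t
    3 ≤ (if m.rank (y + 1) < m.rank y then k.bind .north (m.kind (y + 1)) else 0) +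
      ((if r.rank y < m.rank y then k.bind .east (r.kind y) else 0) +
      ((if m.rank (y - 1) < m.rank y then k.bind .south (m.kind (y - 1)) else 0) +
      (if l.rank y < m.rank y then k.bind .west (l.kind y) else 0))) := by
  simp only [bitColumn, bitKind, hy, if_false, Bool.false_eq_true] at hk
  split_ifs at hk with h1 h2 h3 <;> cases hk
  · subst h1
    apply three_le_of_south
    simp [bitColumn, bitKind, Kind.bind, Kind.glue, Side.opposite, glueStrength, strength]
  · subst h2
    have h : (bitColumn false i a c t).rank 1 < (bitColumn false i a c t).rank 2 := by
      simp [bitColumn]; omega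
    have h' : l.rank 2 < (bitColumn false i a c t).rank 2 := by simpa [bitColumn] using hlt
    have h2 : 2 ≤ (Kind.wire c).bind .south ((bitColumn false i a c t).kind 1) := by
      simp [bitColumn, bitKind, Kind.bind, Kind.glue, Side.opposite, glueStrength, strength]
    norm_num only
    rw [if_pos h, if_pos h']
    omega
  · subst h3
    apply three_le_of_south
    simp [bitColumn, bitKind, Kind.bind, Kind.glue, Side.opposite, glueStrength, strength]

theorem fits_left (i a c j b d : Bool) {t : ℕ} (ht : 2 ≤ t) : Column.Fits
    (bitColumn false i a c t) (bitColumn false j b c (t + 1)) (midColumn false b d c (t + 1)) where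
  unique := (uniqueAt_left i a c j b d).all (isLow_bitKind _ _ _ _) (isLow_bitKind _ _ _ _)
    (isLow_midKind _ _ _ _)
  supported := by
    apply supported_bitColumn (by omega)
    · change 1 ≤ (Kind.wire c).bind .west (bitKind false i a c 2)
      decide +revert
    · simp [bitColumn]

theorem one_le_wire_bind_midColumn (f a b c : Bool) (t : ℕ) :
    1 ≤ (Kind.wire (carryOut a b c)).bind .west ((midColumn f a b c t).kind 2) := by
  change 1 ≤ (Kind.wire (carryOut a b c)).bind .west (midKind f a b c 2)
  decide +revert

theorem supported_right {r : Column} (f a b c i : Bool) {t : ℕ} (ht : 2 ≤ t) (y : ℤ) (k : Kind)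
    (hy : y ≠ 0)
    (hk : (bitColumn false i b (carryOut a b c) (carryTime a b t + 1)).kind y = some k) :
    letI l := midColumn f a b c t
    letI m := bitColumn false i b (carryOut a b c) (carryTime a b t + 1)
    3 ≤ (if m.rank (y + 1) < m.rank y then k.bind .north (m.kind (y + 1)) else 0) +
      ((if r.rank y < m.rank y then k.bind .east (r.kind y) else 0) +
      ((if m.rank (y - 1) < m.rank y then k.bind .south (m.kind (y - 1)) else 0) +
      (if l.rank y < m.rank y then k.bind .west (l.kind y) else 0))) := by
  apply supported_bitColumn
  · unfold carryTime; split_ifs <;> omega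
  · exact one_le_wire_bind_midColumn f a b c t
  · simp [midColumn]
  · exact hy
  · exact hk

theorem fits_right {f a b : Bool} (hf : f = true → a = b) (c i j d : Bool) {t : ℕ} (ht : 2 ≤ t) :
    Column.Fits (midColumn f a b c t)
      (bitColumn false i b (carryOut a b c) (carryTime a b t + 1))
      (bitColumn false j d (carryOut a b c) (carryTime a b t + 2)) where
  unique := (uniqueAt_right f a b c i j d hf).all (isLow_midKind _ _ _ _) (isLow_bitKind _ _ _ _)
    (isLow_bitKind _ _ _ _)
  supported := supported_right f a b c i ht

theorem fits_last {f a b : Bool} (hf : f = true → a = b) (c i : Bool) {t : ℕ} (ht : 2 ≤ t) :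
    Column.Fits (midColumn f a b c t)
      (bitColumn false i b (carryOut a b c) (carryTime a b t + 1))
      (seedColumn (some .rightCap)) where
  unique := (uniqueAt_last f a b c i hf).all (isLow_midKind _ _ _ _) (isLow_bitKind _ _ _ _)
    (isLow_seedKind _)
  supported := supported_right f a b c i ht

theorem supported_mid {f a b : Bool} (hf : f = true → a = b) (c i j c' : Bool) {t : ℕ}
    (ht : 3 ≤ t) (t' : ℕ) (y : ℤ) (k : Kind) (hy : y ≠ 0)
    (hk : (midColumn f a b c t).kind y = some k) :
    letI l := bitColumn f i a c t
    letI m := midColumn f a b c t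
    letI r := bitColumn false j b c' t'
    3 ≤ (if m.rank (y + 1) < m.rank y then k.bind .north (m.kind (y + 1)) else 0) +
      ((if r.rank y < m.rank y then k.bind .east (r.kind y) else 0) +
      ((if m.rank (y - 1) < m.rank y then k.bind .south (m.kind (y - 1)) else 0) +
      (if l.rank y < m.rank y then k.bind .west (l.kind y) else 0))) := by
  have ht2 : 2 < t + 1 := by omega
  have ht3 : 3 < t + 2 := by omega
  simp only [midColumn, midKind, hy, if_false] at hk
  split_ifs at hk with h1 h2 h3 h4 h5 h6 <;> cases hk
  · subst h1
    simp [bitColumn, bitKind, midColumn, midKind, Kind.bind, Kind.glue, Side.opposite,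
      glueStrength, strength]
  · subst h2
    apply three_le_of_south
    simp [midColumn, midKind, Kind.bind, Kind.glue, Side.opposite,
      glueStrength, strength, carryTime, h3]
  · subst h2
    have hf' : f = false := by cases f <;> simp_all
    subst hf'
    simp [bitColumn, bitKind, midColumn, midKind, Kind.bind, Kind.glue, Side.opposite,
      glueStrength, strength, carryTime, h3, ht2]
  · subst h4
    have hf' : f = false := by cases f <;> simp_all
    subst hf'
    simp [bitColumn, bitKind, midColumn, midKind, Kind.bind, Kind.glue, Side.opposite,
      glueStrength, strength, carryTime, h5, ht3]
  · subst h4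
    apply three_le_of_south
    simp [midColumn, midKind, Kind.bind, Kind.glue, Side.opposite,
      glueStrength, strength, carryTime, h5]

theorem fits_mid (i a c j b : Bool) {t : ℕ} (ht : 3 ≤ t) :
    Column.Fits (bitColumn false i a c t) (midColumn false a b c t)
      (bitColumn false j b (carryOut a b c) (carryTime a b t + 1)) where
  unique := (uniqueAt_mid i a c j b).all (isLow_bitKind _ _ _ _) (isLow_midKind _ _ _ _)
    (isLow_bitKind _ _ _ _)
  supported := supported_mid (by simp) c i j _ ht _

theorem fits_firstMid (i a c j : Bool) {t : ℕ} (ht : 3 ≤ t) :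
    Column.Fits (bitColumn true i a c t) (midColumn true a a c t)
      (bitColumn false j a (carryOut a a c) (carryTime a a t + 1)) where
  unique := by
    have : carryOut a a c = a := by simp [carryOut]
    rw [this]
    exact (uniqueAt_firstMid i a c j).all (isLow_bitKind _ _ _ _) (isLow_midKind _ _ _ _)
      (isLow_bitKind _ _ _ _)
  supported := supported_mid (by simp) c i j _ ht _

/-! ### The final assembly, its growth and its ranks. -/

section Final

variable (n : ℕ) (a b : ℕ → Bool)

/-- The carry into position `i`. -/
def carry : ℕ → Bool
  | 0 => false
  | i + 1 => carryOut (a i) (b i) (carry i)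

/-- The time at which the carry reaches position `i`. -/
def time : ℕ → ℕ
  | 0 => 5
  | i + 1 => carryTime (a i) (b i) (time i) + 2

def isInput (i : ℕ) : Bool := decide (1 ≤ i ∧ i ≤ n)

/-- The columns of the final assembly for the summands with bits `a 1, …, a n` and `b 1, …, b n`,
least significant bit first, with a padding position at either end. -/
def column (x : ℤ) : Column :=
  if x = -1 then seedColumn (some .leftCap) else
  if x = 3 * (n + 2) then seedColumn (some .rightCap) else
  if x < -1 ∨ 3 * (n + 2) < x then seedColumn none else
  let i := (x / 3).toNat
  if x % 3 = 0 then
    bitColumn (decide (i = 0)) (isInput n i) (a i) (carry a b i) (time a b i) else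
  if x % 3 = 1 then midColumn (decide (i = 0)) (a i) (b i) (carry a b i) (time a b i) else
  bitColumn false (isInput n i) (b i) (carryOut (a i) (b i) (carry a b i))
    (carryTime (a i) (b i) (time a b i) + 1)

theorem column_leftCap : column n a b (-1) = seedColumn (some .leftCap) := by
  simp [column]

theorem column_rightCap : column n a b (3 * (n + 2)) = seedColumn (some .rightCap) := by
  rw [column, if_neg (by omega), if_pos rfl]

theorem column_outside {x : ℤ} (hx : x < -1 ∨ 3 * ((n : ℤ) + 2) < x) :
    column n a b x = seedColumn none := by
  rw [column, if_neg (by omega), if_neg (by omega), if_pos hx]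

theorem column_a {i : ℕ} (hi : i ≤ n + 1) : column n a b (3 * i) =
    bitColumn (decide (i = 0)) (isInput n i) (a i) (carry a b i) (time a b i) := by
  have h : ((3 * (i : ℤ)) / 3).toNat = i := by omega
  rw [column, if_neg (by omega), if_neg (by omega), if_neg (by omega)]
  simp only [h]
  rw [if_pos (by omega)]

theorem column_mid {i : ℕ} (hi : i ≤ n + 1) : column n a b (3 * i + 1) =
    midColumn (decide (i = 0)) (a i) (b i) (carry a b i) (time a b i) := by
  have h : ((3 * (i : ℤ) + 1) / 3).toNat = i := by omega
  rw [column, if_neg (by omega), if_neg (by omega), if_neg (by omega)]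
  simp only [h]
  rw [if_neg (by omega), if_pos (by omega)]

theorem column_b {i : ℕ} (hi : i ≤ n + 1) : column n a b (3 * i + 2) =
    bitColumn false (isInput n i) (b i) (carryOut (a i) (b i) (carry a b i))
      (carryTime (a i) (b i) (time a b i) + 1) := by
  have h : ((3 * (i : ℤ) + 2) / 3).toNat = i := by omega
  rw [column, if_neg (by omega), if_neg (by omega), if_neg (by omega)]
  simp only [h]
  rw [if_neg (by omega), if_neg (by omega)]

theorem column_cases (x : ℤ) : (x < -1 ∨ 3 * ((n : ℤ) + 2) < x) ∨ x = -1 ∨ x = 3 * (n + 2) ∨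
    ∃ i : ℕ, i ≤ n + 1 ∧ (x = 3 * i ∨ x = 3 * i + 1 ∨ x = 3 * i + 2) := by
  by_cases h : 0 ≤ x ∧ x < 3 * ((n : ℤ) + 2)
  · right; right; right
    exact ⟨(x / 3).toNat, by omega, by omega⟩
  · omega

theorem isLow_column (x : ℤ) : IsLow (column n a b x).kind := by
  rcases column_cases n x with hx | rfl | rfl | ⟨i, hi, rfl | rfl | rfl⟩
  · rw [column_outside n a b hx]; exact isLow_seedKind _
  · rw [column_leftCap]; exact isLow_seedKind _
  · rw [column_rightCap]; exact isLow_seedKind _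
  · rw [column_a n a b hi]; exact isLow_bitKind _ _ _ _
  · rw [column_mid n a b hi]; exact isLow_midKind _ _ _ _
  · rw [column_b n a b hi]; exact isLow_bitKind _ _ _ _

theorem three_le_time (i : ℕ) : 3 ≤ time a b i := by
  cases i with
  | zero => simp [time]
  | succ i => simp only [time, carryTime]; split_ifs <;> omega

theorem two_le_carryTime (u v : Bool) {t : ℕ} (ht : 2 ≤ t) : 2 ≤ carryTime u v t + 1 := by
  unfold carryTime; split_ifs <;> omega

/-- The equality of the bits at position 0 lets a `gen` tile start the first carry there, where none
arrives from the west. -/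
theorem fits_column (h0 : a 0 = b 0) (x : ℤ) :
    (column n a b (x - 1)).Fits (column n a b x) (column n a b (x + 1)) := by
  rcases column_cases n x with hx | rfl | rfl | ⟨i, hi, rfl | rfl | rfl⟩
  · rw [column_outside n a b hx]
    refine fits_seedColumn ?_ (isLow_column _ _ _ _) (isLow_column _ _ _ _)
    by_cases h1 : x = -2
    · subst h1
      rw [column_outside n a b (by omega), show (-2 : ℤ) + 1 = -1 by norm_num, column_leftCap]
      exact uniqueAt_before
    · by_cases h2 : x = 3 * ((n : ℤ) + 2) + 1
      · subst h2
        rw [add_sub_cancel_right, column_rightCap, column_outside n a b (by omega)]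
        exact uniqueAt_after
      · rw [column_outside n a b (by omega), column_outside n a b (by omega)]
        exact uniqueAt_empty
  · rw [column_leftCap]
    refine fits_seedColumn ?_ (isLow_column _ _ _ _) (isLow_column _ _ _ _)
    have h : (-1 : ℤ) + 1 = 3 * (0 : ℕ) := by norm_num
    rw [column_outside n a b (by omega), h, column_a n a b (by omega)]
    exact uniqueAt_leftCap _ _ _
  · rw [column_rightCap]
    refine fits_seedColumn ?_ (isLow_column _ _ _ _) (isLow_column _ _ _ _)
    have h : 3 * ((n : ℤ) + 2) - 1 = 3 * (n + 1 : ℕ) + 2 := by push_cast; ring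
    rw [h, column_b n a b le_rfl, column_outside n a b (by omega)]
    exact uniqueAt_rightCap _ _ _
  · rw [column_a n a b hi, column_mid n a b hi]
    rcases i with _ | i
    · have h : 3 * ((0 : ℕ) : ℤ) - 1 = -1 := by norm_num
      rw [h, column_leftCap, ← h0]
      exact fits_firstBit _ _ _ _
    · have h : 3 * ((i + 1 : ℕ) : ℤ) - 1 = 3 * i + 2 := by push_cast; ring
      rw [h, column_b n a b (by omega)]
      exact fits_left _ _ _ _ _ _ (two_le_carryTime _ _ (by linarith [three_le_time a b i]))
  · have h : 3 * (i : ℤ) + 1 + 1 = 3 * i + 2 := by ring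
    rw [column_mid n a b hi, add_sub_cancel_right, column_a n a b hi, h, column_b n a b hi]
    rcases i with _ | i
    · rw [← h0]
      exact fits_firstMid _ _ _ _ (three_le_time a b 0)
    · exact fits_mid _ _ _ _ _ (three_le_time a b (i + 1))
  · have h : 3 * (i : ℤ) + 2 - 1 = 3 * i + 1 := by ring
    have hf : decide (i = 0) = true → a i = b i := by
      intro hi0
      rw [decide_eq_true_eq] at hi0
      rw [hi0, h0]
    have ht : 2 ≤ time a b i := by linarith [three_le_time a b i]
    rw [column_b n a b hi, h, column_mid n a b hi]
    by_cases hi' : i = n + 1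
    · have h' : 3 * (i : ℤ) + 2 + 1 = 3 * (n + 2) := by rw [hi']; push_cast; ring
      rw [h', column_rightCap]
      exact fits_last hf _ _ ht
    · have h' : 3 * (i : ℤ) + 2 + 1 = 3 * (i + 1 : ℕ) := by push_cast; ring
      rw [h', column_a n a b (by omega)]
      exact fits_right hf _ _ _ _ ht

/-- The final assembly. -/
def final : Assembly Glue where
  tile p := ((column n a b p.1).kind p.2).map Kind.tile
  finite_support := by
    refine ((Set.finite_Icc (-1 : ℤ) (3 * (n + 2))).prod (Set.finite_Icc (0 : ℤ) 3)).subset ?_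
    rintro ⟨x, y⟩ hp
    have hp' : (column n a b x).kind y ≠ none := by
      intro h
      apply hp
      simp [h]
    constructor
    · by_contra hx
      rw [Set.mem_Icc] at hx
      apply hp'
      rw [column_outside n a b (by dsimp at hx; omega)]
      simp [seedColumn, seedKind]
    · by_contra hy
      rw [Set.mem_Icc] at hy
      exact hp' (isLow_column n a b x y (by dsimp at hy; omega))

def rank (p : ℤ × ℤ) : ℕ := (column n a b p.1).rank p.2

theorem final_support (k : Kind) (p : ℤ × ℤ) : (final n a b).support strength k.tile p =
    k.bind .north ((column n a b p.1).kind (p.2 + 1)) +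
      (k.bind .east ((column n a b (p.1 + 1)).kind p.2) +
      (k.bind .south ((column n a b p.1).kind (p.2 - 1)) +
        k.bind .west ((column n a b (p.1 - 1)).kind p.2))) := by
  obtain ⟨x, y⟩ := p
  simp [Assembly.support, Side.sum_eq, final, Kind.tile_bind, Side.vec, sub_eq_add_neg]

theorem kind_east {x : ℤ} (h1 : -1 ≤ x) (h2 : x < 3 * (n + 2)) :
    ∃ k, (column n a b x).kind 0 = some k ∧ k.glue .east = some .row := by
  rcases column_cases n x with hx | rfl | rfl | ⟨i, hi, rfl | rfl | rfl⟩
  · omega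
  · exact ⟨_, by rw [column_leftCap]; rfl, rfl⟩
  · omega
  · exact ⟨_, by rw [column_a n a b hi]; rfl, rfl⟩
  · exact ⟨_, by rw [column_mid n a b hi]; rfl, rfl⟩
  · exact ⟨_, by rw [column_b n a b hi]; rfl, rfl⟩

theorem kind_west {x : ℤ} (h1 : -1 < x) (h2 : x ≤ 3 * (n + 2)) :
    ∃ k, (column n a b x).kind 0 = some k ∧ k.glue .west = some .row := by
  rcases column_cases n x with hx | rfl | rfl | ⟨i, hi, rfl | rfl | rfl⟩
  · omega
  · omega
  · exact ⟨_, by rw [column_rightCap]; rfl, rfl⟩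
  · exact ⟨_, by rw [column_a n a b hi]; rfl, rfl⟩
  · exact ⟨_, by rw [column_mid n a b hi]; rfl, rfl⟩
  · exact ⟨_, by rw [column_b n a b hi]; rfl, rfl⟩

variable {n a b}

section Seed

variable {S : Assembly Glue}

theorem mem_dom_seed
    (hS : ∀ p, S.tile p = if p.2 = 0 then (final n a b).tile p else none)
    {p : ℤ × ℤ} : p ∈ S.dom ↔ p.2 = 0 ∧ -1 ≤ p.1 ∧ p.1 ≤ 3 * (n + 2) := by
  obtain ⟨x, y⟩ := p
  rw [Assembly.mem_dom, hS]
  by_cases hy : y = 0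
  · subst hy
    simp only [if_true, true_and]
    constructor
    · intro h
      by_contra hx
      apply h
      change ((column n a b x).kind 0).map _ = none
      rw [column_outside n a b (by omega)]
      rfl
    · rintro ⟨h1, h2⟩
      change ((column n a b x).kind 0).map _ ≠ none
      rcases h2.lt_or_eq with h2 | h2
      · obtain ⟨k, hk, -⟩ := kind_east n a b h1 h2
        simp [hk]
      · obtain ⟨k, hk, -⟩ := kind_west n a b (x := x) (by omega) h2.le
        simp [hk]
  · simp [hy]

theorem three_le_bond_seed
    (hS : ∀ p, S.tile p = if p.2 = 0 then (final n a b).tile p else none)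
    {x : ℤ} (h1 : -1 ≤ x) (h2 : x < 3 * (n + 2)) :
    3 ≤ S.bond strength (x, 0) (x + 1, 0) := by
  obtain ⟨k, hk, hk'⟩ := kind_east n a b h1 h2
  obtain ⟨l, hl, hl'⟩ := kind_west n a b (x := x + 1) (by omega) (by omega)
  have e1 : S.tile (x, 0) = some k.tile := by simp [hS, final, hk]
  have e2 : S.tile (x + 1, 0) = some l.tile := by simp [hS, final, hl]
  simp [Assembly.bond, e1, e2, Side.sum_eq, Side.vec, Kind.tile, Side.opposite, hk', hl',
    glueStrength, strength]

/-- Consecutive seed tiles are bonded with strength 3, so a cut of weight below 3 cannot separate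
any two of them and is trivial. -/
theorem stable_seed
    (hS : ∀ p, S.tile p = if p.2 = 0 then (final n a b).tile p else none) :
    S.Stable strength 3 := by
  intro X hX hne hX'
  by_contra hc
  have key : ∀ p ∈ X, ∀ q ∈ S.dom \ X, S.bond strength p q < 3 := by
    intro p hp q hq
    by_contra h
    apply hc
    push Not at h
    refine h.trans ((Finset.single_le_sum (f := fun q => S.bond strength p q)
      (fun _ _ => Nat.zero_le _) hq).trans ?_)
    exact Finset.single_le_sum (f := fun p => ∑ q ∈ S.dom \ X, S.bond strength p q)
      (fun _ _ => Nat.zero_le _) hp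
  have step : ∀ x : ℤ, -1 ≤ x → x < 3 * (n + 2) → ((x, (0 : ℤ)) ∈ X ↔ (x + 1, (0 : ℤ)) ∈ X) := by
    intro x h1 h2
    have hb := three_le_bond_seed hS h1 h2
    constructor
    · intro h
      by_contra h'
      have := key _ h (x + 1, 0) (Finset.mem_sdiff.2
        ⟨(mem_dom_seed hS).2 ⟨rfl, by dsimp only; omega, by dsimp only; omega⟩, h'⟩)
      omega
    · intro h
      by_contra h'
      have := key _ h (x, 0) (Finset.mem_sdiff.2
        ⟨(mem_dom_seed hS).2 ⟨rfl, by dsimp only; omega, by dsimp only; omega⟩, h'⟩)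
      rw [Assembly.bond_comm] at this
      omega
  have all : ∀ x : ℤ, -1 ≤ x → x ≤ 3 * (n + 2) → ((-1, (0 : ℤ)) ∈ X ↔ (x, (0 : ℤ)) ∈ X) := by
    intro x hx
    induction x, hx using Int.leInduction with
    | base => exact fun _ => Iff.rfl
    | succ x hx ih => exact fun h => (ih (by omega)).trans (step x hx (by omega))
  have mem : ∀ p ∈ S.dom, ((-1, (0 : ℤ)) ∈ X ↔ p ∈ X) := by
    rintro ⟨x, y⟩ hp
    obtain ⟨rfl, h1, h2⟩ := (mem_dom_seed hS).1 hp
    exact all x h1 h2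
  obtain ⟨p, hp⟩ := hne
  have h0 := (mem p (hX hp)).2 hp
  exact hX' (hX.antisymm fun q hq => (mem q hq).1 h0)

theorem growsTo_final
    (hS : ∀ p, S.tile p = if p.2 = 0 then (final n a b).tile p else none)
    (h0 : a 0 = b 0) : GrowsTo ⟨tileSet, S, 3⟩ (final n a b) (rank n a b) where
  temp_pos := by norm_num
  stable := stable_seed hS
  nonempty := ⟨(-1, 0), (mem_dom_seed hS).2 ⟨rfl, le_rfl, by dsimp only; omega⟩⟩
  seed_le p t h := by
    change S.tile p = _ at h
    rw [hS] at h
    split_ifs at h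
    exact h
  mem_tiles p t h := by
    obtain ⟨k, -, hk⟩ := Option.map_eq_some_iff.1 h
    exact mem_tileSet.2 ⟨k, hk⟩
  unique p hp t ht h := by
    obtain ⟨k, rfl⟩ := mem_tileSet.1 ht
    change 3 ≤ (final n a b).support strength k.tile p at h
    rw [final_support] at h
    have := (fits_column n a b h0 p.1).unique p.2 k (by
      intro hy
      change S.tile p = none at hp
      rw [hS, if_pos hy] at hp
      rw [← hy]
      exact Option.map_eq_none_iff.1 hp) h
    exact Option.map_eq_some_iff.2 ⟨k, this, rfl⟩
  supported p t ht hp := by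
    obtain ⟨k, hk, rfl⟩ := Option.map_eq_some_iff.1 ht
    have hy : p.2 ≠ 0 := by
      intro hy
      change S.tile p = none at hp
      rw [hS, if_pos hy, ht] at hp
      simp at hp
    have := (fits_column n a b h0 p.1).supported p.2 k hy hk
    obtain ⟨x, y⟩ := p
    simpa [Side.sum_eq, final, tileSet, Kind.tile_bind, Side.vec, rank, sub_eq_add_neg] using this

end Seed

/-- Here `e` counts the unequal positions directly before `i`. An equal position resets the clock to
`3 + 2`; an unequal one adds a `prop` and two `wire` tiles. The conventional value 5 at position 0,
which no carry reaches, fits the same formula. -/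
theorem time_le (a b : ℕ → Bool) (i : ℕ) :
    ∃ e ≤ i, time a b i = 5 + 3 * e ∧ ∀ k, i - e ≤ k → k < i → a k ≠ b k := by
  induction i with
  | zero => exact ⟨0, le_rfl, rfl, fun k _ hk => absurd hk (Nat.not_lt_zero k)⟩
  | succ i ih =>
    obtain ⟨e, he, ht, hk⟩ := ih
    by_cases h : a i = b i
    · exact ⟨0, Nat.zero_le _, by simp [time, carryTime, h], fun k h1 h2 => by omega⟩
    · refine ⟨e + 1, by omega, by simp only [time, carryTime, h, if_false]; omega, ?_⟩
      intro k h1 h2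
      rcases Nat.lt_succ_iff_lt_or_eq.1 h2 with h3 | rfl
      · exact hk k (by omega) h3
      · exact h

/-- At a position reached at time `t` the latest tile is the `top` over the second bit, at time at
most `t + 3`: after `prop` and `wire`. -/
theorem rank_le {L : ℕ} (hL : ∀ i ≤ n + 1, time a b i ≤ 5 + 3 * L) (p : ℤ × ℤ) :
    rank n a b p ≤ 8 + 3 * L := by
  obtain ⟨x, y⟩ := p
  change (column n a b x).rank y ≤ _
  rcases column_cases n x with hx | rfl | rfl | ⟨i, hi, rfl | rfl | rfl⟩
  · rw [column_outside n a b hx]; simp [seedColumn]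
  · rw [column_leftCap]; simp [seedColumn]
  · rw [column_rightCap]; simp [seedColumn]
  · have := hL i hi
    rw [column_a n a b hi]
    simp only [bitColumn]
    split_ifs <;> omega
  · have := hL i hi
    rw [column_mid n a b hi]
    simp only [midColumn, carryTime]
    split_ifs <;> omega
  · have := hL i hi
    rw [column_b n a b hi]
    simp only [bitColumn, carryTime]
    split_ifs <;> omega

end Final

/-! ### Correctness of binary addition with carries. -/

section Sum

variable {a b : ℕ → Bool}

theorem testBit_sum (s : ℕ → Bool) (m j : ℕ) (hj : j < m) :
    (∑ i ∈ Finset.range m, (s i).toNat * 2 ^ i).testBit j = s j := by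
  induction m generalizing s j with
  | zero => omega
  | succ m ih =>
    have h : ∑ i ∈ Finset.range (m + 1), (s i).toNat * 2 ^ i =
        2 * ∑ i ∈ Finset.range m, (s (i + 1)).toNat * 2 ^ i + (s 0).toNat := by
      rw [Finset.sum_range_succ', Finset.mul_sum]
      simp only [pow_zero, mul_one, pow_succ]
      congr 1
      exact Finset.sum_congr rfl fun i _ => by ring
    rw [h]
    cases j with
    | zero => cases s 0 <;> simp
    | succ j =>
      rw [Nat.testBit_succ]
      have hdiv : ∀ N : ℕ, (2 * N + (s 0).toNat) / 2 = N := by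
        intro N
        have := Bool.toNat_lt (s 0)
        omega
      rw [hdiv, ih (fun i => s (i + 1)) j (by omega)]

/-- The digit of the sum at position `i`. -/
def sumDigit (a b : ℕ → Bool) (i : ℕ) : Bool := if a i = b i then carry a b i else !carry a b i

theorem toNat_add_toNat_add_carry (a b : ℕ → Bool) (i : ℕ) :
    (a i).toNat + (b i).toNat + (carry a b i).toNat =
      (sumDigit a b i).toNat + 2 * (carry a b (i + 1)).toNat := by
  simp only [sumDigit, carry, carryOut]
  cases a i <;> cases b i <;> cases carry a b i <;> rfl

/-- The full-adder identity is weighted by powers of 2 and summed; the carries telescope. -/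
theorem sum_add_sum (h1 : carry a b 1 = false) (m : ℕ) :
    ∑ i ∈ Finset.range m, (a (i + 1)).toNat * 2 ^ i +
      ∑ i ∈ Finset.range m, (b (i + 1)).toNat * 2 ^ i =
    ∑ i ∈ Finset.range m, (sumDigit a b (i + 1)).toNat * 2 ^ i +
      (carry a b (m + 1)).toNat * 2 ^ m := by
  induction m with
  | zero => simp [h1]
  | succ m ih =>
    have := toNat_add_toNat_add_carry a b (m + 1)
    simp only [Finset.sum_range_succ]
    linear_combination ih + 2 ^ m * this

end Sum

/-! ### Input template, output template and the adder. -/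

section Template

variable {n : ℕ}

/-- The bits of a summand as a sequence with index `1, …, n`, least significant bit first. -/
def digits (u : Fin n → Bool) (i : ℕ) : Bool :=
  if h : 1 ≤ i ∧ i ≤ n then u ⟨n - i, by omega⟩ else false

theorem digits_sub (u : Fin n → Bool) (j : Fin n) : digits u (n - j) = u j := by
  rw [digits, dif_pos (by omega)]
  congr 1
  ext
  simp only
  omega

theorem digits_of_lt (u : Fin n → Bool) {i : ℕ} (hi : n < i) : digits u i = false := by
  rw [digits, dif_neg (by omega)]

theorem digits_zero (u : Fin n → Bool) : digits u 0 = false := by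
  rw [digits, dif_neg (by omega)]

theorem binaryValue_eq (u : Fin n → Bool) :
    binaryValue u = ∑ i ∈ Finset.range (n + 1), (digits u (i + 1)).toNat * 2 ^ i := by
  rw [Finset.sum_range_succ, digits_of_lt u (Nat.lt_succ_self n), Bool.toNat_false, zero_mul,
    add_zero, ← Fin.sum_univ_eq_sum_range (fun i => (digits u (i + 1)).toNat * 2 ^ i), binaryValue,
    ← Equiv.sum_comp Fin.revPerm]
  refine Finset.sum_congr rfl fun j _ => ?_
  have h := digits_sub u j.rev
  rw [Fin.val_rev, show n - (n - (j + 1 : ℕ)) = j + 1 by omega] at h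
  simp [h]

theorem testBit_add_eq (u v : Fin n → Bool) (i : ℕ) (hi : i < n + 1) :
    (binaryValue u + binaryValue v).testBit i = sumDigit (digits u) (digits v) (i + 1) := by
  have h1 : carry (digits u) (digits v) 1 = false := by
    simp [carry, carryOut, digits_zero]
  -- The padding bits at position `n + 1` are both 0, so that position absorbs the last carry as the
  -- top digit of the sum.
  have h2 : carry (digits u) (digits v) (n + 2) = false := by
    simp [carry, carryOut, digits_of_lt]
  rw [binaryValue_eq, binaryValue_eq, sum_add_sum h1, h2, Bool.toNat_false, zero_mul, add_zero,
    testBit_sum _ _ _ hi]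

/-- The seed row with its input tiles removed. -/
def frameKind : Option Kind → Option Kind
  | some (.bit true _) => none
  | o => o

theorem frameKind_eq_some {o : Option Kind} {k : Kind} (h : frameKind o = some k) :
    o = some k ∧ ∀ v, k ≠ .bit true v := by
  unfold frameKind at h
  split at h
  · simp at h
  · rename_i h'
    exact ⟨h, fun v hk => h' v (by rw [h, hk])⟩

def wild (n : ℕ) : Fin (n + n) → ℤ × ℤ :=
  Fin.addCases (fun j => (3 * ((n - j : ℕ) : ℤ), 0)) (fun j => (3 * ((n - j : ℕ) : ℤ) + 2, 0))

theorem wild_castAdd (j : Fin n) : wild n (Fin.castAdd n j) = (3 * ((n - j : ℕ) : ℤ), 0) :=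
  Fin.addCases_left j

theorem wild_natAdd (j : Fin n) : wild n (Fin.natAdd n j) = (3 * ((n - j : ℕ) : ℤ) + 2, 0) :=
  Fin.addCases_right j

theorem wild_injective (n : ℕ) : Function.Injective (wild n) := by
  intro i j h
  induction i using Fin.addCases <;> induction j using Fin.addCases <;>
    simp only [wild_castAdd, wild_natAdd, Prod.mk.injEq, and_true] at h
  · congr 1; ext; omega
  · omega
  · omega
  · congr 1; ext; omega

theorem column_kind_castAdd (a b : ℕ → Bool) (j : Fin n) :
    (column n a b (3 * ((n - j : ℕ) : ℤ))).kind 0 = some (.bit true (a (n - j))) := by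
  rw [column_a n a b (by omega)]
  have : isInput n (n - j) = true := by simp only [isInput, decide_eq_true_eq]; omega
  rw [this]
  rfl

theorem column_kind_natAdd (a b : ℕ → Bool) (j : Fin n) :
    (column n a b (3 * ((n - j : ℕ) : ℤ) + 2)).kind 0 = some (.bit true (b (n - j))) := by
  rw [column_b n a b (by omega)]
  have : isInput n (n - j) = true := by simp only [isInput, decide_eq_true_eq]; omega
  rw [this]
  rfl

theorem label_of_not_input {k : Kind} (hk : ∀ v, k ≠ .bit true v) {x : ℤ} {a b : ℕ → Bool}
    (h : (column n a b x).kind 0 = some k) : k.label = [] := by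
  rcases column_cases n x with hx | rfl | rfl | ⟨i, hi, rfl | rfl | rfl⟩
  · rw [column_outside n a b hx] at h
    cases h
  · rw [column_leftCap] at h
    cases h; rfl
  · rw [column_rightCap] at h
    cases h; rfl
  · rw [column_a n a b hi] at h
    cases h
    cases hi : isInput n i <;> simp_all [Kind.label]
  · rw [column_mid n a b hi] at h
    cases h; rfl
  · rw [column_b n a b hi] at h
    cases h
    cases hi : isInput n i <;> simp_all [Kind.label]

def frame (n : ℕ) : Assembly Glue where
  tile p := if p.2 = 0 then
    (frameKind ((column n (fun _ => false) (fun _ => false) p.1).kind 0)).map Kind.tile else none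
  finite_support := by
    refine (final n (fun _ => false) (fun _ => false)).finite_support.subset ?_
    rintro ⟨x, y⟩ hp
    simp only [Set.mem_ofPred_eq, ne_eq] at hp
    split_ifs at hp with hy
    swap
    · exact absurd rfl hp
    subst hy
    obtain ⟨t, ht⟩ := Option.ne_none_iff_exists'.1 hp
    obtain ⟨k, hk, -⟩ := Option.map_eq_some_iff.1 ht
    change ((column n (fun _ => false) (fun _ => false) x).kind 0).map Kind.tile ≠ none
    simp [(frameKind_eq_some hk).1]

theorem frame_tile (n : ℕ) (x : ℤ) : (frame n).tile (x, 0) =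
    (frameKind ((column n (fun _ => false) (fun _ => false) x).kind 0)).map Kind.tile := by
  simp [frame]

def template (n : ℕ) : InputTemplate tileSet (n + n) where
  t₀ := (Kind.bit true false).tile
  t₁ := (Kind.bit true true).tile
  t₀_mem := mem_tileSet.2 ⟨_, rfl⟩
  t₁_mem := mem_tileSet.2 ⟨_, rfl⟩
  t₀_label := rfl
  t₁_label := rfl
  frame := frame n
  frame_over p t h := by
    simp only [frame] at h
    split_ifs at h
    obtain ⟨k, hk, rfl⟩ := Option.map_eq_some_iff.1 h
    obtain ⟨hk', hb⟩ := frameKind_eq_some hk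
    have hl : k.tile.label = [] := label_of_not_input hb hk'
    exact ⟨mem_tileSet.2 ⟨k, rfl⟩, by simp [hl], by simp [hl]⟩
  wild := wild n
  wild_injective := wild_injective n
  wild_free i := by
    induction i using Fin.addCases with
    | left j => rw [wild_castAdd, frame_tile, column_kind_castAdd]; rfl
    | right j => rw [wild_natAdd, frame_tile, column_kind_natAdd]; rfl

theorem bitTile_template (x : Bool) : (template n).bitTile x = (Kind.bit true x).tile := by
  cases x <;> rfl

theorem frameKind_column {x : ℤ} (hx : ∀ i, wild n i ≠ (x, 0)) (u v : Fin n → Bool) :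
    frameKind ((column n (fun _ => false) (fun _ => false) x).kind 0) =
      (column n (digits u) (digits v) x).kind 0 := by
  have hpad : ∀ i : ℕ, ¬ (1 ≤ i ∧ i ≤ n) →
      isInput n i = false ∧ digits u i = false ∧ digits v i = false := by
    intro i hi
    simp [isInput, digits, hi]
  rcases column_cases n x with hx' | rfl | rfl | ⟨i, hi, rfl | rfl | rfl⟩
  · rw [column_outside _ _ _ hx', column_outside _ _ _ hx']; rfl
  · rw [column_leftCap, column_leftCap]; rfl
  · rw [column_rightCap, column_rightCap]; rfl
  · by_cases h : 1 ≤ i ∧ i ≤ n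
    · have := hx (Fin.castAdd n ⟨n - i, by omega⟩)
      rw [wild_castAdd] at this
      simp only [show n - (n - i) = i by omega, ne_eq, not_true_eq_false] at this
    · obtain ⟨h1, h2, h3⟩ := hpad i h
      rw [column_a _ _ _ hi, column_a _ _ _ hi, h1, h2]; rfl
  · rw [column_mid _ _ _ hi, column_mid _ _ _ hi]; rfl
  · by_cases h : 1 ≤ i ∧ i ≤ n
    · have := hx (Fin.natAdd n ⟨n - i, by omega⟩)
      rw [wild_natAdd] at this
      simp only [show n - (n - i) = i by omega, ne_eq, not_true_eq_false] at this
    · obtain ⟨h1, h2, h3⟩ := hpad i h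
      rw [column_b _ _ _ hi, column_b _ _ _ hi, h1, h3]; rfl

/-- Apart from the wildcards, row 0 of the final assembly does not depend on the input, so one
frame, read off from the zero input, serves all. -/
theorem fill_template (r : Fin (n + n) → Bool) (p : ℤ × ℤ) : ((template n).fill r).tile p =
    if p.2 = 0 then (final n (digits (addendA r)) (digits (addendB r))).tile p else none := by
  by_cases h : ∃ i, wild n i = p
  · obtain ⟨i, rfl⟩ := h
    refine ((template n).fill_wild r i).trans ?_
    rw [bitTile_template]
    induction i using Fin.addCases with
    | left j =>
      rw [wild_castAdd, if_pos rfl]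
      change _ = ((column n _ _ (3 * ((n - j : ℕ) : ℤ))).kind 0).map Kind.tile
      rw [column_kind_castAdd, digits_sub]
      rfl
    | right j =>
      rw [wild_natAdd, if_pos rfl]
      change _ = ((column n _ _ (3 * ((n - j : ℕ) : ℤ) + 2)).kind 0).map Kind.tile
      rw [column_kind_natAdd, digits_sub]
      rfl
  · push Not at h
    refine ((template n).fill_frame r p h).trans ?_
    obtain ⟨x, y⟩ := p
    change (frame n).tile (x, y) = _
    simp only [frame]
    split_ifs with hy
    · subst hy
      rw [frameKind_column h (addendA r) (addendB r)]
      rfl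
    · rfl

/-- The carry-skip adder. -/
def adder (n : ℕ) : TAC Glue (n + n) (n + 1) where
  T := tileSet
  U := template n
  V t := (3 * ((n + 1 - t : ℕ) : ℤ) + 1, 3)
  temp := 3

theorem growsTo_adder (r : Fin (n + n) → Bool) : GrowsTo ((adder n).system r)
    (final n (digits (addendA r)) (digits (addendB r)))
    (rank n (digits (addendA r)) (digits (addendB r))) :=
  growsTo_final (fill_template r) (by simp [digits_zero])

/-- The lengths of the blocks of positions at which the addends differ. -/
def unequalRuns (r : Fin (n + n) → Bool) : Set ℕ :=
  {k : ℕ | ∃ s : ℕ, s + k ≤ n ∧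
    ∀ j : Fin n, s ≤ (j : ℕ) → (j : ℕ) < s + k → addendA r j ≠ addendB r j}

theorem bddAbove_unequalRuns (r : Fin (n + n) → Bool) : BddAbove (unequalRuns r) :=
  ⟨n, by rintro k ⟨s, h, -⟩; omega⟩

theorem longestUnequalRun_spec (r : Fin (n + n) → Bool) :
    ∃ s : ℕ, s + longestUnequalRun r ≤ n ∧ ∀ j : Fin n, s ≤ (j : ℕ) →
      (j : ℕ) < s + longestUnequalRun r → addendA r j ≠ addendB r j := by
  have h0 : (unequalRuns r).Nonempty := ⟨0, 0, Nat.zero_le _, fun j _ h => by omega⟩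
  exact Nat.sSup_mem h0 (bddAbove_unequalRuns r)

theorem longestUnequalRun_le (r : Fin (n + n) → Bool) : longestUnequalRun r ≤ n := by
  obtain ⟨s, h, -⟩ := longestUnequalRun_spec r
  omega

theorem time_le_longestUnequalRun (r : Fin (n + n) → Bool) (i : ℕ) :
    time (digits (addendA r)) (digits (addendB r)) i ≤ 5 + 3 * longestUnequalRun r := by
  obtain ⟨e, he, ht, hk⟩ := time_le (digits (addendA r)) (digits (addendB r)) i
  rw [ht]
  have hrange : ∀ k, digits (addendA r) k ≠ digits (addendB r) k → 1 ≤ k ∧ k ≤ n := by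
    intro k h
    by_contra hc
    simp [digits, hc] at h
  suffices e ≤ longestUnequalRun r by omega
  rcases Nat.eq_zero_or_pos e with rfl | hpos
  · exact Nat.zero_le _
  have hi := hrange _ (hk (i - 1) (by omega) (by omega))
  have hie := hrange _ (hk (i - e) le_rfl (by omega))
  -- Input strings start with the most significant bit: position `k` has index `n - k`, so the run
  -- from `i - e` to `i - 1` starts at index `n - (i - 1)`.
  refine le_csSup (bddAbove_unequalRuns r) ⟨n + 1 - i, by omega, fun j h1 h2 => ?_⟩
  rw [← digits_sub (addendA r), ← digits_sub (addendB r)]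
  exact hk _ (by omega) (by omega)

theorem adder_spec (r : Fin (n + n) → Bool) :
    ((adder n).system r).UniquelyAssembles (final n (digits (addendA r)) (digits (addendB r))) ∧
      (adder n).runTime r ≤ ((8 + 3 * longestUnequalRun r : ℕ) : ℕ∞) :=
  (growsTo_adder r).spec fun p _ _ => rank_le (fun i _ => time_le_longestUnequalRun r i) p

theorem isAdder_adder (n : ℕ) : (adder n).IsAdder := by
  intro r
  refine ⟨⟨(growsTo_adder r).temp_pos, (growsTo_adder r).stable⟩, _, (adder_spec r).1, ?_⟩
  intro t
  have hbit : addBits n r t =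
      sumDigit (digits (addendA r)) (digits (addendB r)) (n + 1 - t) := by
    rw [addBits, binaryDigits, testBit_add_eq _ _ _ (by omega)]
    congr 1
    rw [Fin.val_rev]
    omega
  have hne : n + 1 - (t : ℕ) ≠ 0 := by omega
  rw [hbit]
  generalize digits (addendA r) = a
  generalize digits (addendB r) = b
  change ∃ u, ((column n a b (3 * ((n + 1 - t : ℕ) : ℤ) + 1)).kind 3).map Kind.tile = some u ∧ _
  rw [column_mid n a b (by omega)]
  simp only [midColumn, midKind, sumDigit, hne, decide_false]
  split_ifs <;> simp_all [Kind.tile, Kind.label]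

theorem onLine_template (n : ℕ) : (template n).OnLine := by
  refine ⟨0, fun p hp => ?_, fun i => ?_⟩
  · rw [Assembly.mem_dom] at hp
    change (frame n).tile p ≠ none at hp
    by_contra h
    simp [frame, h] at hp
  · change (wild n i).2 = 0
    induction i using Fin.addCases with
    | left j => rw [wild_castAdd]
    | right j => rw [wild_natAdd]

end Template

end CarrySkip

/-! ### The mean length of the longest unequal run. -/

section Average

variable {n : ℕ}

/-- The number of inputs whose addends differ at all positions of `W`. -/
theorem card_unequal_mul (W : Finset (Fin n)) :
    (Finset.univ.filter fun r : Fin (n + n) → Bool =>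
      ∀ j ∈ W, addendA r j ≠ addendB r j).card * 2 ^ W.card = 2 ^ (n + n) := by
  let e : (Fin (n + n) → Bool) ≃ (Fin n → Bool × Bool) :=
    (Fin.appendEquiv n n).symm.trans (Equiv.arrowProdEquivProdArrow _ _ _).symm
  have he : ∀ r j, e r j = (addendA r j, addendB r j) := fun r j => rfl
  have hcard : (Finset.univ.filter fun r : Fin (n + n) → Bool =>
      ∀ j ∈ W, addendA r j ≠ addendB r j).card =
      (Fintype.piFinset fun j => if j ∈ W then Finset.univ.filter fun x : Bool × Bool => x.1 ≠ x.2
        else Finset.univ).card := by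
    refine Finset.card_equiv e fun r => ?_
    simp only [Finset.mem_filter, Finset.mem_univ, true_and, Fintype.mem_piFinset]
    refine forall_congr' fun j => ?_
    by_cases hj : j ∈ W <;> simp [hj, he]
  have hW : 2 ^ W.card = ∏ j : Fin n, if j ∈ W then 2 else 1 := by
    rw [Finset.prod_ite_mem, Finset.univ_inter, Finset.prod_const]
  rw [hcard, Fintype.card_piFinset, hW, ← Finset.prod_mul_distrib, Finset.prod_eq_pow_card (b := 4)]
  · rw [Finset.card_univ, Fintype.card_fin, ← two_mul, pow_mul]
    norm_num
  · intro j _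
    by_cases hj : j ∈ W
    · simp only [hj, if_true]
      decide
    · simp [hj]

/-- Union bound over the starting point of a run of length `m`; each start is realized by a fraction
`2⁻ᵐ` of the inputs, or by none. -/
theorem card_lt_longestUnequalRun_mul (m : ℕ) :
    (Finset.univ.filter fun r : Fin (n + n) → Bool => m < longestUnequalRun r).card * 2 ^ m ≤
      n * 2 ^ (n + n) := by
  let E : ℕ → Finset (Fin (n + n) → Bool) := fun s => Finset.univ.filter fun r =>
    s + m ≤ n ∧ ∀ j : Fin n, s ≤ (j : ℕ) → (j : ℕ) < s + m → addendA r j ≠ addendB r j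
  have hE : ∀ s, (E s).card * 2 ^ m ≤ 2 ^ (n + n) := by
    intro s
    by_cases hs : s + m ≤ n
    · let W : Finset (Fin n) := (Finset.Ico s (s + m)).attachFin fun j hj => by
        rw [Finset.mem_Ico] at hj; omega
      have hW : W.card = m := by simp [W]
      rw [← card_unequal_mul W, hW]
      refine Nat.mul_le_mul_right _ (Finset.card_le_card fun r hr => ?_)
      rw [Finset.mem_filter] at hr ⊢
      refine ⟨hr.1, fun j hj => ?_⟩
      rw [Finset.mem_attachFin, Finset.mem_Ico] at hj
      exact hr.2.2 j hj.1 hj.2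
    · have : E s = ∅ := Finset.filter_eq_empty_iff.2 fun r _ h => hs h.1
      simp [this]
  have hsub : (Finset.univ.filter fun r : Fin (n + n) → Bool => m < longestUnequalRun r) ⊆
      (Finset.range n).biUnion E := by
    intro r hr
    rw [Finset.mem_filter] at hr
    obtain ⟨s, hs, h⟩ := CarrySkip.longestUnequalRun_spec r
    rw [Finset.mem_biUnion]
    refine ⟨s, Finset.mem_range.2 (by omega), Finset.mem_filter.2 ⟨hr.1, by omega, ?_⟩⟩
    exact fun j h1 h2 => h j h1 (by omega)
  calc _ ≤ (∑ s ∈ Finset.range n, (E s).card) * 2 ^ m :=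
        Nat.mul_le_mul_right _ ((Finset.card_le_card hsub).trans Finset.card_biUnion_le)
    _ = ∑ s ∈ Finset.range n, (E s).card * 2 ^ m := Finset.sum_mul _ _ _
    _ ≤ ∑ s ∈ Finset.range n, 2 ^ (n + n) := Finset.sum_le_sum fun s _ => hE s
    _ = n * 2 ^ (n + n) := by simp

theorem sum_longestUnequalRun_le (m : ℕ) (hm : n * n ≤ 2 ^ m) :
    ∑ r : Fin (n + n) → Bool, longestUnequalRun r ≤ (m + 1) * 2 ^ (n + n) := by
  have h1 : ∀ r : Fin (n + n) → Bool,
      longestUnequalRun r ≤ m + n * if m < longestUnequalRun r then 1 else 0 := by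
    intro r
    have := CarrySkip.longestUnequalRun_le r
    split_ifs <;> omega
  have h2 : n * (Finset.univ.filter fun r : Fin (n + n) → Bool => m < longestUnequalRun r).card ≤
      2 ^ (n + n) := by
    refine Nat.le_of_mul_le_mul_right ?_ (Nat.two_pow_pos m)
    calc _ = n * ((Finset.univ.filter fun r : Fin (n + n) → Bool =>
          m < longestUnequalRun r).card * 2 ^ m) := mul_assoc _ _ _
      _ ≤ n * (n * 2 ^ (n + n)) := Nat.mul_le_mul_left _ (card_lt_longestUnequalRun_mul m)
      _ = n * n * 2 ^ (n + n) := (mul_assoc _ _ _).symm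
      _ ≤ 2 ^ m * 2 ^ (n + n) := Nat.mul_le_mul_right _ hm
      _ = _ := mul_comm _ _
  refine (Finset.sum_le_sum fun r _ => h1 r).trans ?_
  rw [Finset.sum_add_distrib, ← Finset.mul_sum, Finset.sum_boole, Finset.sum_const,
    Finset.card_univ, Fintype.card_fun, Fintype.card_fin, Fintype.card_bool, Nat.cast_id,
    smul_eq_mul]
  linarith

theorem averageRunTime_le {G : Type} [DecidableEq G] {k : ℕ} (M : TAC G (n + n) k) (hn : 2 ≤ n)
    (hM : ∀ r, M.runTime r ≤ ((8 * (longestUnequalRun r + 1) : ℕ) : ℕ∞)) :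
    M.averageRunTime ≤ ENNReal.ofReal ((96 : ℕ) * Real.log n) := by
  set l := Nat.log 2 n with hl
  have hm : n * n ≤ 2 ^ (2 * (l + 1)) := by
    have := (Nat.lt_pow_succ_log_self one_lt_two n).le
    rw [two_mul, pow_add]
    exact Nat.mul_le_mul this this
  have hsum : ∑ r, (M.runTime r : ℝ≥0∞) ≤ ((8 * (2 * (l + 1) + 2) * 2 ^ (n + n) : ℕ) : ℝ≥0∞) := by
    have hr : ∀ r, (M.runTime r : ℝ≥0∞) ≤ ((8 * (longestUnequalRun r + 1) : ℕ) : ℝ≥0∞) :=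
      fun r => by
        have := ENat.toENNReal_le.2 (hM r)
        rwa [ENat.toENNReal_coe] at this
    refine (Finset.sum_le_sum fun r _ => hr r).trans ?_
    rw [← Nat.cast_sum, Nat.cast_le, ← Finset.mul_sum, Finset.sum_add_distrib, Finset.sum_const,
      Finset.card_univ, Fintype.card_fun, Fintype.card_fin, Fintype.card_bool, smul_eq_mul]
    have := sum_longestUnequalRun_le _ hm
    linarith
  -- The left side is `16 * l + 32`. From `log 2 > 1 / 2` one gets `l ≤ 2 * log n` and, as `n ≥ 2`,
  -- also `1 ≤ 2 * log n`; hence `32 + 64 = 96`.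
  have hlog : ((8 * (2 * (l + 1) + 2) : ℕ) : ℝ) ≤ (96 : ℕ) * Real.log n := by
    have hn0 : (0 : ℝ) < n := by positivity
    have h1 : (l : ℝ) * Real.log 2 ≤ Real.log n := by
      rw [← Real.log_pow]
      refine Real.log_le_log (by positivity) ?_
      exact_mod_cast Nat.pow_log_le_self 2 (by omega)
    have h2 : Real.log 2 ≤ Real.log n := Real.log_le_log two_pos (by exact_mod_cast hn)
    have h3 := Real.log_two_gt_d9
    have h4 : (l : ℝ) * (1 / 2) ≤ l * Real.log 2 :=
      mul_le_mul_of_nonneg_left (by linarith) (Nat.cast_nonneg l)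
    push_cast
    linarith
  refine ENNReal.div_le_of_le_mul (hsum.trans ?_)
  rw [Nat.cast_mul, Nat.cast_pow, Nat.cast_ofNat]
  refine mul_le_mul_left ?_ _
  rw [← ENNReal.ofReal_natCast]
  exact ENNReal.ofReal_le_ofReal hlog

end Average

end TileAssembly

end

theorem mainTheorem7 :
    ∃ (G : Type) (_ : DecidableEq G) (T : TileAssembly.TileSet G) (τ C : ℕ),
      ∀ n : ℕ, 1 ≤ n → ∃ M : TileAssembly.TAC G (n + n) (n + 1),
        M.T = T ∧ M.temp = τ ∧ M.U.OnLine ∧ M.IsAdder ∧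
        M.worstCaseRunTime ≤ ((C * n : ℕ) : ℕ∞) ∧
        (2 ≤ n → M.averageRunTime ≤ ENNReal.ofReal (C * Real.log n)) ∧
        ∀ r : Fin (n + n) → Bool,
          M.runTime r ≤ ((C * (TileAssembly.longestUnequalRun r + 1) : ℕ) : ℕ∞) := by
  refine ⟨TileAssembly.CarrySkip.Glue, inferInstance, TileAssembly.CarrySkip.tileSet, 3, 96,
    fun n hn => ⟨TileAssembly.CarrySkip.adder n, rfl, rfl,
      TileAssembly.CarrySkip.onLine_template n, TileAssembly.CarrySkip.isAdder_adder n, ?_⟩⟩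
  have hrun : ∀ r, (TileAssembly.CarrySkip.adder n).runTime r ≤
      ((8 * (TileAssembly.longestUnequalRun r + 1) : ℕ) : ℕ∞) := fun r =>
    (TileAssembly.CarrySkip.adder_spec r).2.trans (Nat.cast_le.2 (by omega))
  refine ⟨iSup_le fun r => (hrun r).trans (Nat.cast_le.2 ?_),
    fun hn2 => TileAssembly.averageRunTime_le _ hn2 hrun,
    fun r => (hrun r).trans (Nat.cast_le.2 (by omega))⟩
  -- Since `n ≥ 1`, the bound `8 * (n + 1)` is at most `16 * n`.
  have := TileAssembly.CarrySkip.longestUnequalRun_le r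
  omega
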